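/- Let $g : (0,\infty)\to(0,\infty)$ be a continuous probability density, let $\mu\in\mathbb R$, and let $(X_1,W_1),(X_2,W_2),\dots$ be IID pairs such that $W_i>0$ has Lebesgue density $g$ and $X_i\mid W_i\sim\mathcal N(\mu,W_i)$. Let $G(u)=\mathbb P(W_1\le u)$, let $H=G^{-1}:[0,1)\to[0,\infty)$ be the inverse of the strictly increasing function $G:[0,\infty)\to[0,1)$, and put, for $t>1$, $$B(t)=\frac1{H(1/t)},\qquad A(t)=t\int_0^{B(t)}G(1/u)\,du .$$ A function $f$ that is positive near $a\in\{0,\infty\}$ is called regularly varying at $a$ with index $b$ if $f(st)/f(t)\to s^b$ as $t\to a$ for every $s>0$. Assume that $G$ is regularly varying at $0$ with index $\beta\in(0,1]$. Almost surely, for every $n\ge1$, the likelihood of $\mu$ based on $(X_1,W_1),\dots,(X_n,W_n)$ has a unique maximizer, the maximum likelihood estimate $$\hat\mu_n=\frac{X_1/W_1+\dots+X_n/W_n}{1/W_1+\dots+1/W_n},$$ and the following hold, where $Z\sim\mathcal N(0,1)$. (a) $B$ is regularly varying at infinity with index $1/\beta$. If $\beta=1$, then $A$ is regularly varying at infinity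 with index $1$. (b) If $\beta<1$, then $\sqrt{B(n)}\,(\hat\mu_n-\mu)\to U_\beta^{-1/2}Z$ in distribution as $n\to\infty$, where $U_\beta>0$ is the $\beta$-stable subordinator variable, independent of $Z$, whose law exists and is given by $\mathbb E[e^{-\lambda U_\beta}]=\exp(-\Gamma(1-\beta)\lambda^\beta)$ for $\lambda>0$. (c) If $\beta=1$ and $\mathbb E[1/W_1]=\infty$, then $\sqrt{A(n)}\,(\hat\mu_n-\mu)\to Z$ in distribution as $n\to\infty$. -/

import Mathlib

open MeasureTheory ProbabilityTheory Filter Set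
open scoped Topology NNReal ENNReal

noncomputable section

namespace VarianceMixture

/-- `f` is regularly varying along the filter `l` (which is `atTop` for infinity and `𝓝[>] 0` for
zero) with index `b`: it is positive near the limit point, and `f (s t) / f t → s ^ b` as `t` tends
to the limit point, for every `s > 0`. -/
def RegVarAt (f : ℝ → ℝ) (l : Filter ℝ) (b : ℝ) : Prop :=
  (∀ᶠ t in l, 0 < f t) ∧ ∀ s : ℝ, 0 < s → Tendsto (fun t => f (s * t) / f t) l (𝓝 (s ^ b))

/-- The law `Q` on `(0, ∞)` with Lebesgue density `g` on `(0, ∞)`. -/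
def mixingLaw (g : ℝ → ℝ) : Measure ℝ :=
  (volume.restrict (Ioi 0)).withDensity (fun w => ENNReal.ofReal (g w))

/-- The Markov kernel `w ↦ N(μ, w)`, for a variance `w > 0`. -/
def gaussianKernel (μ : ℝ) : Kernel ℝ ℝ where
  toFun w := gaussianReal μ w.toNNReal
  measurable' := measurable_gaussianReal.comp
    (measurable_const.prodMk measurable_real_toNNReal)

/-- The joint density of `(X, W)` on `ℝ × (0, ∞)` for the parameter value `m`. -/
def jointDensity (g : ℝ → ℝ) (m x w : ℝ) : ℝ :=
  g w * ((√(2 * Real.pi * w))⁻¹ * Real.exp (-(x - m) ^ 2 / (2 * w)))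

/-- The log-likelihood of the parameter value `m` for the sample
`(x 0, w 0), …, (x (n - 1), w (n - 1))`. -/
def logLik (g : ℝ → ℝ) (n : ℕ) (x w : ℕ → ℝ) (m : ℝ) : ℝ :=
  ∑ i ∈ Finset.range n, Real.log (jointDensity g m (x i) (w i))

/-- The estimate `(x₁ / w₁ + … + xₙ / wₙ) / (1 / w₁ + … + 1 / wₙ)`. -/
def mle (n : ℕ) (x w : ℕ → ℝ) : ℝ :=
  (∑ i ∈ Finset.range n, x i / w i) / (∑ i ∈ Finset.range n, 1 / w i)

/-- The cumulative distribution function `G` of the law with density `g`. -/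
def G (g : ℝ → ℝ) (u : ℝ) : ℝ := cdf (mixingLaw g) u

/-- The inverse `H : [0, 1) → [0, ∞)` of `G : [0, ∞) → [0, 1)`. -/
def H (g : ℝ → ℝ) : ℝ → ℝ := Function.invFunOn (G g) (Ici 0)

/-- `B t = 1 / H (1 / t)`, meaningful for `t > 1`. -/
def B (g : ℝ → ℝ) (t : ℝ) : ℝ := 1 / H g (1 / t)

/-- `A t = t ∫₀^{B t} G (1 / u) du`, meaningful for `t > 1`. -/
def A (g : ℝ → ℝ) (t : ℝ) : ℝ := t * ∫ u in (0 : ℝ)..B g t, G g (1 / u)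

/-- `ν` is the law of the (positive) `β`-stable subordinator `U_β`, normalized by
`E exp (-lam U_β) = exp (-Γ(1 - β) lam ^ β)`. -/
structure IsStableSubordinatorLaw (β : ℝ) (ν : Measure ℝ) : Prop where
  isProb : IsProbabilityMeasure ν
  ae_pos : ∀ᵐ u ∂ν, 0 < u
  laplace : ∀ lam : ℝ, 0 < lam →
    ∫ u, Real.exp (-(lam * u)) ∂ν = Real.exp (-(Real.Gamma (1 - β) * lam ^ β))

end VarianceMixture

end

open VarianceMixture

/-! Write S for the sum of the 1 / W_i, i ≤ n. Given the variances, the error of the estimate is a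
centred Gaussian of variance 1 / S, so its characteristic function after scaling by √c is the mean
of exp(-(t² / 2) / (S / c)) (`charFun_mle`). Both limit theorems thus reduce to the limit law of S /
c.

S is a sum of IID positive variables with tail F(u) = G(1 / u), regularly varying at infinity with
index -β. The Laplace transform of S / c is the n-th power of φ(lam / c), where 1 - φ(r) = r ∫
exp(-r u) F(u) du over u > 0 (`one_sub_laplace`), so it remains to find the limit of n (1 - φ(lam /
c)).

If β < 1, take c = B n, for which n F(B n) = 1. After rescaling, the integrand tends to lam exp(-lam
v) v^(-β), whose integral is Γ(1 - β) lam^β; Potter's bound supplies the domination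
(`tendsto_laplace_of_regVar`). If β = 1 that integral diverges at 0, and the truncated mean L(x) =
∫₀ˣ F takes over: Karamata's relation x F(x) / L(x) → 0 shows that ∫ exp(-r u) F(u) du is asymptotic
to L(x) when r = lam F(x) / L(x) (`tendsto_laplace_of_regVar_one`). With x = B n this r is lam / A
n, and S / A n tends to the constant 1.

To return from Laplace transforms to laws, y = exp(-u) maps [0, ∞] onto [0, 1] and Laplace
transforms become moments. Weierstrass approximation gives convergence of the means of exp(-a / u)
(`tendsto_integral_exp_neg_div`); compactness of the probability measures on [0, 1] gives existence
of the stable law (`exists_measure_of_tendsto_laplace`).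

Part (a) comes from inverting the regularly varying G and from the slow variation of L. -/

namespace VarianceMixture

/-! ### Potter bounds for monotone tails -/

/-- Potter-type lower bound: if `F u ≤ 2 ^ δ F (2 u)` eventually, then `F u u ^ δ` is almost
increasing. -/
lemma mul_rpow_le_of_doubling {F : ℝ → ℝ} (hanti : AntitoneOn F (Ioi 0))
    (hpos : ∀ u, 0 < u → 0 < F u) {δ u₀ : ℝ} (hδ : 0 < δ) (hu₀ : 0 < u₀)
    (h : ∀ u, u₀ ≤ u → F u ≤ 2 ^ δ * F (2 * u)) {u y : ℝ} (hu : u₀ ≤ u) (huy : u ≤ y) :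
    F u * u ^ δ ≤ 2 ^ δ * (F y * y ^ δ) := by
  -- Induction on the number of doublings from `u` to `y`. A full doubling does not decrease `F u *
  -- u ^ δ`, so the factor `2 ^ δ` is lost only once, in the last incomplete step.
  have key : ∀ n : ℕ, ∀ u y : ℝ, u₀ ≤ u → u ≤ y → y ≤ 2 ^ n * u →
      F u * u ^ δ ≤ 2 ^ δ * (F y * y ^ δ) := by
    have base : ∀ u y : ℝ, u₀ ≤ u → u ≤ y → y ≤ 2 * u →
        F u * u ^ δ ≤ 2 ^ δ * (F y * y ^ δ) := by
      intro u y hu huy hy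
      have hu0 : 0 < u := hu₀.trans_le hu
      have hy0 : 0 < y := hu0.trans_le huy
      have h1 : F (2 * u) ≤ F y := hanti hy0 (by simp; linarith) hy
      have h2 : u ^ δ ≤ y ^ δ := Real.rpow_le_rpow hu0.le huy hδ.le
      calc F u * u ^ δ ≤ (2 ^ δ * F y) * y ^ δ := by
            apply mul_le_mul _ h2 (by positivity) (by have := hpos y hy0; positivity)
            exact (h u hu).trans (mul_le_mul_of_nonneg_left h1 (by positivity))
        _ = _ := by ring
    intro n
    induction n with
    | zero =>
      intro u y hu huy hy
      exact base u y hu huy (by linarith [hu₀.trans_le hu, pow_zero (2 : ℝ)])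
    | succ n ih =>
      intro u y hu huy hy
      have hu0 : 0 < u := hu₀.trans_le hu
      rcases le_total y (2 * u) with hy2 | hy2
      · exact base u y hu huy hy2
      · refine le_trans ?_ (ih (2 * u) y (by linarith) hy2 (by rw [pow_succ] at hy; linarith))
        rw [Real.mul_rpow (by norm_num) hu0.le]
        calc F u * u ^ δ ≤ (2 ^ δ * F (2 * u)) * u ^ δ :=
              mul_le_mul_of_nonneg_right (h u hu) (by positivity)
          _ = _ := by ring
  have hu0 : 0 < u := hu₀.trans_le hu
  obtain ⟨n, hn⟩ := pow_unbounded_of_one_lt (y / u) (one_lt_two)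
  exact key n u y hu huy (by rw [div_lt_iff₀ hu0] at hn; exact hn.le)

/-- Potter-type upper bound: if `2 ^ δ F (2 u) ≤ F u` eventually, then `F u u ^ δ` is almost
decreasing. -/
lemma mul_rpow_le_of_halving {F : ℝ → ℝ} (hanti : AntitoneOn F (Ioi 0))
    (hpos : ∀ u, 0 < u → 0 < F u) {δ u₀ : ℝ} (hδ : 0 < δ) (hu₀ : 0 < u₀)
    (h : ∀ u, u₀ ≤ u → 2 ^ δ * F (2 * u) ≤ F u) {u y : ℝ} (hu : u₀ ≤ u) (huy : u ≤ y) :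
    F y * y ^ δ ≤ 2 ^ δ * (F u * u ^ δ) := by
  have key : ∀ n : ℕ, ∀ u y : ℝ, u₀ ≤ u → u ≤ y → y ≤ 2 ^ n * u →
      F y * y ^ δ ≤ 2 ^ δ * (F u * u ^ δ) := by
    have base : ∀ u y : ℝ, u₀ ≤ u → u ≤ y → y ≤ 2 * u →
        F y * y ^ δ ≤ 2 ^ δ * (F u * u ^ δ) := by
      intro u y hu huy hy
      have hu0 : 0 < u := hu₀.trans_le hu
      have hy0 : 0 < y := hu0.trans_le huy
      have h1 : F y ≤ F u := hanti hu0 hy0 huy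
      have h2 : y ^ δ ≤ 2 ^ δ * u ^ δ := by
        rw [← Real.mul_rpow (by norm_num) hu0.le]
        exact Real.rpow_le_rpow hy0.le hy hδ.le
      calc F y * y ^ δ ≤ F u * (2 ^ δ * u ^ δ) :=
            mul_le_mul h1 h2 (by positivity) (hpos u hu0).le
        _ = _ := by ring
    intro n
    induction n with
    | zero =>
      intro u y hu huy hy
      exact base u y hu huy (by linarith [hu₀.trans_le hu, pow_zero (2 : ℝ)])
    | succ n ih =>
      intro u y hu huy hy
      have hu0 : 0 < u := hu₀.trans_le hu
      rcases le_total y (2 * u) with hy2 | hy2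
      · exact base u y hu huy hy2
      · refine le_trans (ih (2 * u) y (by linarith) hy2 (by rw [pow_succ] at hy; linarith)) ?_
        rw [Real.mul_rpow (by norm_num) hu0.le]
        have := mul_le_mul_of_nonneg_right (h u hu) (show 0 ≤ 2 ^ δ * u ^ δ by positivity)
        linarith
  have hu0 : 0 < u := hu₀.trans_le hu
  obtain ⟨n, hn⟩ := pow_unbounded_of_one_lt (y / u) (one_lt_two)
  exact key n u y hu huy (by rw [div_lt_iff₀ hu0] at hn; exact hn.le)

/-- **Potter's bound** for `v ≤ 1`. -/
lemma exists_potter_le_one {F : ℝ → ℝ} (hanti : AntitoneOn F (Ioi 0))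
    (hpos : ∀ u, 0 < u → 0 < F u) (hle : ∀ u, F u ≤ 1) {β δ : ℝ} (hδ : 0 < δ) (hβδ : β < δ)
    (hRV : Tendsto (fun u => F (2 * u) / F u) atTop (𝓝 (2 ^ (-β)))) :
    ∃ C x₀ : ℝ, 0 < C ∧ 0 < x₀ ∧ ∀ x, x₀ ≤ x → ∀ v, 0 < v → v ≤ 1 →
      F (x * v) ≤ C * v ^ (-δ) * F x := by
  have hlt : (2 : ℝ) ^ (-δ) < 2 ^ (-β) :=
    Real.rpow_lt_rpow_of_exponent_lt one_lt_two (by linarith)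
  obtain ⟨a, ha⟩ := eventually_atTop.1
    ((hRV.eventually (lt_mem_nhds hlt)).and (eventually_gt_atTop (0 : ℝ)))
  set u₀ := max a 1 with hu₀
  have hu₀0 : 0 < u₀ := lt_max_of_lt_right one_pos
  have hd : ∀ u, u₀ ≤ u → F u ≤ 2 ^ δ * F (2 * u) := by
    intro u hu
    obtain ⟨h1, h2⟩ := ha u ((le_max_left _ _).trans hu)
    have h3 := hpos u h2
    rw [lt_div_iff₀ h3] at h1
    have h4 : (2 : ℝ) ^ δ * 2 ^ (-δ) = 1 := by
      rw [← Real.rpow_add two_pos]; simp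
    calc F u = 2 ^ δ * (2 ^ (-δ) * F u) := by rw [← mul_assoc, h4, one_mul]
      _ ≤ _ := mul_le_mul_of_nonneg_left h1.le (by positivity)
  have hFu₀ := hpos u₀ hu₀0
  refine ⟨2 ^ δ / F u₀, u₀, by positivity, hu₀0, fun x hx v hv hv1 => ?_⟩
  have hx0 : 0 < x := hu₀0.trans_le hx
  have hFx := hpos x hx0
  have hvδ : 0 < v ^ δ := by positivity
  rw [Real.rpow_neg hv.le]
  rcases le_total u₀ (x * v) with hxv | hxv
  · have h1 := mul_rpow_le_of_doubling hanti hpos hδ hu₀0 hd hxv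
      (show x * v ≤ x by nlinarith)
    rw [Real.mul_rpow hx0.le hv.le] at h1
    have hxδ : 0 < x ^ δ := by positivity
    have h2 : F (x * v) * v ^ δ ≤ 2 ^ δ * F x := by
      refine le_of_mul_le_mul_right ?_ hxδ
      linarith
    have h3 : 2 ^ δ * F x ≤ 2 ^ δ / F u₀ * F x := by
      refine mul_le_mul_of_nonneg_right ?_ hFx.le
      rw [le_div_iff₀ hFu₀]
      exact mul_le_of_le_one_right (by positivity) (hle _)
    rw [mul_right_comm, ← div_eq_mul_inv, le_div_iff₀ hvδ]
    exact h2.trans h3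
  -- Here `x * v` lies below the threshold and only `F ≤ 1` is available there. The lower bound on
  -- `F x * x ^ δ` started at `u₀` compensates; this accounts for `1 / F u₀` in the constant.
  · have h1 := mul_rpow_le_of_doubling hanti hpos hδ hu₀0 hd le_rfl hx
    have h2 : x ^ δ * v ^ δ ≤ u₀ ^ δ := by
      rw [← Real.mul_rpow hx0.le hv.le]
      exact Real.rpow_le_rpow (by positivity) hxv hδ.le
    have hu₀δ : 0 < u₀ ^ δ := by positivity
    rw [mul_right_comm, ← div_eq_mul_inv, le_div_iff₀ hvδ, div_mul_eq_mul_div,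
      le_div_iff₀ hFu₀]
    refine le_of_mul_le_mul_right ?_ hu₀δ
    calc F (x * v) * v ^ δ * F u₀ * u₀ ^ δ ≤ 1 * v ^ δ * F u₀ * u₀ ^ δ := by
          gcongr; exact hle _
      _ = v ^ δ * (F u₀ * u₀ ^ δ) := by ring
      _ ≤ v ^ δ * (2 ^ δ * (F x * x ^ δ)) := by gcongr
      _ = 2 ^ δ * F x * (x ^ δ * v ^ δ) := by ring
      _ ≤ _ := by gcongr

/-- **Potter's bound** for `v ≥ 1`. -/
lemma exists_potter_one_le {F : ℝ → ℝ} (hanti : AntitoneOn F (Ioi 0))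
    (hpos : ∀ u, 0 < u → 0 < F u) {β δ : ℝ} (hδ : 0 < δ) (hβδ : δ < β)
    (hRV : Tendsto (fun u => F (2 * u) / F u) atTop (𝓝 (2 ^ (-β)))) :
    ∃ C x₀ : ℝ, 0 < C ∧ 0 < x₀ ∧ ∀ x, x₀ ≤ x → ∀ y, x ≤ y →
      F y * y ^ δ ≤ C * (F x * x ^ δ) := by
  have hlt : (2 : ℝ) ^ (-β) < 2 ^ (-δ) :=
    Real.rpow_lt_rpow_of_exponent_lt one_lt_two (by linarith)
  obtain ⟨a, ha⟩ := eventually_atTop.1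
    ((hRV.eventually (gt_mem_nhds hlt)).and (eventually_gt_atTop (0 : ℝ)))
  have hu₀0 : 0 < max a 1 := lt_max_of_lt_right one_pos
  refine ⟨2 ^ δ, max a 1, by positivity, hu₀0, fun x hx y hy =>
    mul_rpow_le_of_halving hanti hpos hδ hu₀0 (fun u hu => ?_) hx hy⟩
  obtain ⟨h1, h2⟩ := ha u ((le_max_left _ _).trans hu)
  have h3 := hpos u h2
  rw [div_lt_iff₀ h3] at h1
  have h4 : (2 : ℝ) ^ δ * 2 ^ (-δ) = 1 := by
    rw [← Real.rpow_add two_pos]; simp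
  calc 2 ^ δ * F (2 * u) ≤ 2 ^ δ * (2 ^ (-δ) * F u) :=
        mul_le_mul_of_nonneg_left h1.le (by positivity)
    _ = F u := by rw [← mul_assoc, h4, one_mul]

/-! ### Abelian theorem, index below one -/

/-- The Abelian theorem for the tail `F` of index `-β`, `β < 1`. -/
lemma tendsto_laplace_of_regVar {F : ℝ → ℝ} (hm : Measurable F) (hanti : AntitoneOn F (Ioi 0))
    (hpos : ∀ u, 0 < u → 0 < F u) (hle : ∀ u, F u ≤ 1) {β : ℝ} (hβ0 : 0 < β) (hβ1 : β < 1)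
    (hRV : ∀ s : ℝ, 0 < s → Tendsto (fun u => F (s * u) / F u) atTop (𝓝 (s ^ (-β))))
    {lam : ℝ} (hlam : 0 < lam) :
    Tendsto (fun b => ∫ v in Ioi (0 : ℝ), lam * Real.exp (-(lam * v)) * (F (v * b) / F b)) atTop
      (𝓝 (Real.Gamma (1 - β) * lam ^ β)) := by
  -- The exponent lies strictly between β, as Potter's bound needs, and 1, as integrability at 0
  -- needs.
  obtain ⟨C, x₀, hC, hx₀, hpot⟩ := exists_potter_le_one hanti hpos hle
    (δ := (1 + β) / 2) (by linarith) (by linarith) (hRV 2 two_pos)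
  have hlim : ∫ v in Ioi (0 : ℝ), lam * Real.exp (-(lam * v)) * v ^ (-β) =
      Real.Gamma (1 - β) * lam ^ β := by
    have h := Real.integral_rpow_mul_exp_neg_mul_Ioi (a := 1 - β) (r := lam) (by linarith) hlam
    calc ∫ v in Ioi (0 : ℝ), lam * Real.exp (-(lam * v)) * v ^ (-β)
        = ∫ v in Ioi (0 : ℝ), lam * (v ^ ((1 - β) - 1) * Real.exp (-(lam * v))) := by
          congr 1; ext v; rw [show (1 - β) - 1 = -β by ring]; ring
      _ = lam * ((1 / lam) ^ (1 - β) * Real.Gamma (1 - β)) := by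
          rw [integral_const_mul, h]
      _ = _ := by
          rw [one_div, Real.inv_rpow hlam.le, Real.rpow_sub hlam, Real.rpow_one]
          field_simp
  rw [← hlim]
  have hexp : ∀ s : ℝ, -1 < s →
      IntegrableOn (fun v : ℝ => v ^ s * Real.exp (-(lam * v))) (Ioi 0) := by
    intro s hs
    have := integrableOn_rpow_mul_exp_neg_mul_rpow hs one_pos hlam
    simpa only [Real.rpow_one, neg_mul] using this
  -- The first summand dominates on `v ≤ 1` by Potter; the second on `v ≥ 1`, where monotonicity
  -- bounds the ratio by 1. Writing that 1 as `v ^ 0` lets `hexp` integrate both.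
  refine tendsto_integral_filter_of_dominated_convergence
    (fun v => lam * C * (v ^ (-((1 + β) / 2)) * Real.exp (-(lam * v))) +
      lam * (v ^ (0 : ℝ) * Real.exp (-(lam * v)))) ?_ ?_ ?_ ?_
  · refine Eventually.of_forall fun b => Measurable.aestronglyMeasurable ?_
    fun_prop
  · filter_upwards [eventually_ge_atTop x₀] with b hb
    refine (ae_restrict_iff' measurableSet_Ioi).2 (Eventually.of_forall fun v (hv : 0 < v) => ?_)
    have hb0 : 0 < b := hx₀.trans_le hb
    have hFb := hpos b hb0
    have hFvb := hpos (v * b) (by positivity)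
    rw [Real.norm_of_nonneg (by positivity)]
    have hvδ : 0 < v ^ (-((1 + β) / 2)) := by positivity
    have : F (v * b) / F b ≤ C * v ^ (-((1 + β) / 2)) + v ^ (0 : ℝ) := by
      rw [div_le_iff₀ hFb, Real.rpow_zero]
      rcases le_total v 1 with hv1 | hv1
      · have := hpot b hb v hv hv1
        rw [mul_comm v b]
        linarith
      · have : F (v * b) ≤ F b := hanti hb0 (by simp; positivity) (by nlinarith)
        have h2 : 0 < C * v ^ (-((1 + β) / 2)) * F b := by positivity
        linarith
    calc lam * Real.exp (-(lam * v)) * (F (v * b) / F b)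
        ≤ lam * Real.exp (-(lam * v)) * (C * v ^ (-((1 + β) / 2)) + v ^ (0 : ℝ)) := by gcongr
      _ = _ := by ring
  · exact ((hexp _ (by linarith)).const_mul _).add ((hexp 0 (by norm_num)).const_mul _)
  · refine (ae_restrict_iff' measurableSet_Ioi).2 (Eventually.of_forall fun v (hv : 0 < v) => ?_)
    exact (hRV v hv).const_mul _

/-! ### The boundary index: Karamata's theorem and slow variation of the truncated mean -/

section IndexOne

variable {F : ℝ → ℝ}

lemma intervalIntegrable_tail (hm : Measurable F) (hnn : ∀ u, 0 ≤ F u) (hle : ∀ u, F u ≤ 1)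
    (a b : ℝ) : IntervalIntegrable F volume a b := by
  refine (intervalIntegrable_const (c := (1 : ℝ))).mono_fun hm.aestronglyMeasurable
    (Eventually.of_forall fun u => ?_)
  simpa [abs_of_nonneg (hnn u)] using hle u

lemma integral_tail_le (hm : Measurable F) (hanti : AntitoneOn F (Ioi 0)) (hnn : ∀ u, 0 ≤ F u)
    (hle : ∀ u, F u ≤ 1) {x y : ℝ} (hx : 0 < x) (hxy : x ≤ y) :
    ∫ u in x..y, F u ≤ (y - x) * F x := by
  have := intervalIntegral.integral_mono_on hxy (intervalIntegrable_tail hm hnn hle x y)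
    (intervalIntegrable_const (c := F x)) (fun u hu => hanti hx (hx.trans_le hu.1) hu.1)
  simpa using this

lemma le_integral_tail (hm : Measurable F) (hanti : AntitoneOn F (Ioi 0)) (hnn : ∀ u, 0 ≤ F u)
    (hle : ∀ u, F u ≤ 1) {x y : ℝ} (hx : 0 ≤ x) (hxy : x ≤ y) :
    (y - x) * F y ≤ ∫ u in x..y, F u := by
  rcases hxy.eq_or_lt with rfl | hlt
  · simp
  have := intervalIntegral.integral_mono_on_of_le_Ioo hxy
    (intervalIntegrable_const (c := F y)) (intervalIntegrable_tail hm hnn hle x y)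
    (fun u hu => hanti (hx.trans_lt hu.1) (hx.trans_lt (hu.1.trans hu.2)) hu.2.le)
  simpa using this

lemma integral_tail_add (hm : Measurable F) (hnn : ∀ u, 0 ≤ F u) (hle : ∀ u, F u ≤ 1)
    (x y : ℝ) : ∫ u in 0..y, F u = (∫ u in 0..x, F u) + ∫ u in x..y, F u :=
  (intervalIntegral.integral_add_adjacent_intervals (intervalIntegrable_tail hm hnn hle _ _)
    (intervalIntegrable_tail hm hnn hle _ _)).symm

lemma integral_tail_mono (hm : Measurable F) (hnn : ∀ u, 0 ≤ F u) (hle : ∀ u, F u ≤ 1) :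
    Monotone fun x => ∫ u in 0..x, F u := by
  intro x y hxy
  simp only
  rw [integral_tail_add hm hnn hle x y]
  linarith [intervalIntegral.integral_nonneg hxy (μ := volume) fun u _ => hnn u]

lemma integral_tail_pos (hm : Measurable F) (hanti : AntitoneOn F (Ioi 0)) (hnn : ∀ u, 0 ≤ F u)
    (hpos : ∀ u, 0 < u → 0 < F u) (hle : ∀ u, F u ≤ 1) {x : ℝ} (hx : 0 < x) :
    0 < ∫ u in 0..x, F u := by
  have h := le_integral_tail hm hanti hnn hle le_rfl hx.le
  have := hpos x hx
  have : 0 < (x - 0) * F x := by rw [sub_zero]; positivity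
  linarith

/-- **Karamata's theorem** in the boundary case of index `-1`. -/
lemma tendsto_mul_div_integral_tail (hm : Measurable F) (hanti : AntitoneOn F (Ioi 0))
    (hnn : ∀ u, 0 ≤ F u) (hpos : ∀ u, 0 < u → 0 < F u) (hle : ∀ u, F u ≤ 1)
    (hRV : ∀ s : ℝ, 0 < s → Tendsto (fun u => F (s * u) / F u) atTop (𝓝 (s ^ (-1 : ℝ)))) :
    Tendsto (fun x => x * F x / ∫ u in 0..x, F u) atTop (𝓝 0) := by
  -- Bootstrap: the integral over the upper half of `[0, x]` is at least `x * F x / 2`, while `(x /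
  -- 2) * F (x / 2)` is asymptotic to `x * F x`. A bound with constant `c'` at `x / 2` therefore
  -- gives nearly `c' + 1 / 2` at `x`, and the constant can be made arbitrarily large.
  have key : ∀ k : ℕ, ∀ c : ℝ, c < k / 2 →
      ∀ᶠ x in atTop, c * (x * F x) ≤ ∫ u in 0..x, F u := by
    intro k
    induction k with
    | zero =>
      intro c hc
      filter_upwards [eventually_gt_atTop 0] with x hx
      have h1 := integral_tail_pos hm hanti hnn hpos hle hx
      have h2 := hpos x hx
      have : c * (x * F x) ≤ 0 :=
        mul_nonpos_of_nonpos_of_nonneg (by simpa using hc.le) (by positivity)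
      linarith
    | succ k ih =>
      intro c hc
      push_cast at hc
      -- The midpoint of `c - 1 / 2` and `k / 2`: small enough for the induction hypothesis, and
      -- with `c' + 1 / 2 > c`.
      set c' := (c - 1 / 2 + k / 2) / 2 with hc'
      have hk : c' < k / 2 := by rw [hc']; linarith
      have hlim : Tendsto (fun x => c' / 2 * (F (1 / 2 * x) / F x) + 1 / 2) atTop
          (𝓝 (c' / 2 * (1 / 2) ^ (-1 : ℝ) + 1 / 2)) :=
        ((hRV (1 / 2) (by norm_num)).const_mul _).add_const _
      have hval : c < c' / 2 * (1 / 2) ^ (-1 : ℝ) + 1 / 2 := by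
        rw [Real.rpow_neg_one]; norm_num; rw [hc']; linarith
      have hhalf : Tendsto (fun x : ℝ => 1 / 2 * x) atTop atTop :=
        tendsto_id.const_mul_atTop (by norm_num)
      filter_upwards [eventually_gt_atTop 0, hlim.eventually (lt_mem_nhds hval),
        hhalf.eventually (ih c' hk)] with x hx h1 h2
      have h3 := le_integral_tail hm hanti hnn hle (x := 1 / 2 * x) (y := x) (by positivity)
        (by linarith)
      rw [integral_tail_add hm hnn hle (1 / 2 * x) x]
      have hFx := hpos x hx
      have h4 := mul_le_mul_of_nonneg_right h1.le (show 0 ≤ x * F x by positivity)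
      have h5 : (c' / 2 * (F (1 / 2 * x) / F x) + 1 / 2) * (x * F x) =
          c' * (1 / 2 * x * F (1 / 2 * x)) + (x - 1 / 2 * x) * F x := by
        field_simp; ring
      linarith
  refine Metric.tendsto_nhds.2 fun ε hε => ?_
  obtain ⟨k, hk⟩ := exists_nat_gt (2 * (2 / ε))
  filter_upwards [key k (2 / ε) (by linarith), eventually_gt_atTop 0] with x h hx
  have h1 := integral_tail_pos hm hanti hnn hpos hle hx
  have h2 := hpos x hx
  rw [Real.dist_eq, sub_zero, abs_of_nonneg (by positivity), div_lt_iff₀ h1]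
  have h3 : x * F x ≤ ε / 2 * ∫ u in 0..x, F u := by
    calc x * F x = ε / 2 * (2 / ε * (x * F x)) := by field_simp
      _ ≤ _ := by gcongr
  nlinarith

/-- The truncated mean is slowly varying. -/
lemma tendsto_integral_tail_mul_div (hm : Measurable F) (hanti : AntitoneOn F (Ioi 0))
    (hnn : ∀ u, 0 ≤ F u) (hpos : ∀ u, 0 < u → 0 < F u) (hle : ∀ u, F u ≤ 1)
    (hRV : ∀ s : ℝ, 0 < s → Tendsto (fun u => F (s * u) / F u) atTop (𝓝 (s ^ (-1 : ℝ))))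
    {c : ℝ} (hc : 0 < c) :
    Tendsto (fun x => (∫ u in 0..c * x, F u) / ∫ u in 0..x, F u) atTop (𝓝 1) := by
  have hge : ∀ c : ℝ, 1 ≤ c →
      Tendsto (fun x => (∫ u in 0..c * x, F u) / ∫ u in 0..x, F u) atTop (𝓝 1) := by
    intro c hc
    have hup : Tendsto (fun x => 1 + (c - 1) * (x * F x / ∫ u in 0..x, F u)) atTop (𝓝 1) := by
      simpa using ((tendsto_mul_div_integral_tail hm hanti hnn hpos hle hRV).const_mul
        (c - 1)).const_add 1
    refine tendsto_of_tendsto_of_tendsto_of_le_of_le' tendsto_const_nhds hup ?_ ?_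
    · filter_upwards [eventually_gt_atTop 0] with x hx
      rw [le_div_iff₀ (integral_tail_pos hm hanti hnn hpos hle hx), one_mul]
      exact integral_tail_mono hm hnn hle (by nlinarith)
    · filter_upwards [eventually_gt_atTop 0] with x hx
      have h1 := integral_tail_pos hm hanti hnn hpos hle hx
      have hxc : x ≤ c * x := by nlinarith
      have h2 := integral_tail_le hm hanti hnn hle hx hxc
      rw [div_le_iff₀ h1, integral_tail_add hm hnn hle x (c * x)]
      calc _ ≤ (∫ u in 0..x, F u) + (c * x - x) * F x := by linarith
        _ = _ := by field_simp
  rcases le_total 1 c with h | h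
  · exact hge c h
  -- For `c ≤ 1`, apply the case `c⁻¹` at the point `c * x` and invert the ratio.
  · have hcx : Tendsto (fun x : ℝ => c * x) atTop atTop := tendsto_id.const_mul_atTop hc
    have h1 := ((hge c⁻¹ ((one_le_inv₀ hc).2 h)).comp hcx).inv₀ one_ne_zero
    rw [inv_one] at h1
    refine h1.congr fun x => ?_
    simp only [Function.comp_apply, inv_div]
    rw [inv_mul_cancel_left₀ hc.ne']

lemma integrableOn_exp_mul_tail (hm : Measurable F) (hnn : ∀ u, 0 ≤ F u) (hle : ∀ u, F u ≤ 1)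
    {r : ℝ} (hr : 0 < r) : IntegrableOn (fun u => Real.exp (-(r * u)) * F u) (Ioi 0) := by
  have h1 : IntegrableOn (fun u : ℝ => Real.exp (-(r * u))) (Ioi 0) := by
    simpa only [neg_mul] using integrableOn_exp_mul_Ioi (neg_lt_zero.2 hr) 0
  refine h1.mono' (by fun_prop) (Eventually.of_forall fun u => ?_)
  rw [Real.norm_of_nonneg (mul_nonneg (Real.exp_pos _).le (hnn u))]
  exact mul_le_of_le_one_right (Real.exp_pos _).le (hle u)

/-- The Abelian theorem for the tail `F` in the boundary case of index `-1`. -/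
lemma tendsto_laplace_of_regVar_one (hm : Measurable F) (hanti : AntitoneOn F (Ioi 0))
    (hnn : ∀ u, 0 ≤ F u) (hpos : ∀ u, 0 < u → 0 < F u) (hle : ∀ u, F u ≤ 1)
    (hRV : ∀ s : ℝ, 0 < s → Tendsto (fun u => F (s * u) / F u) atTop (𝓝 (s ^ (-1 : ℝ))))
    {lam : ℝ} (hlam : 0 < lam) :
    Tendsto (fun x => (∫ u in Ioi (0 : ℝ),
        Real.exp (-(lam * F x / (∫ u in 0..x, F u) * u)) * F u) / ∫ u in 0..x, F u)
      atTop (𝓝 1) := by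
  set L : ℝ → ℝ := fun x => ∫ u in 0..x, F u with hL
  -- Any exponent in `(0, 1)` would do.
  obtain ⟨C, x₀, hC, hx₀, hpot⟩ := exists_potter_one_le hanti hpos (β := 1) (δ := 1 / 2)
    (by norm_num) (by norm_num) (hRV 2 two_pos)
  have hq : Tendsto (fun x => x * F x / L x) atTop (𝓝 0) :=
    tendsto_mul_div_integral_tail hm hanti hnn hpos hle hRV
  have hlow : Tendsto (fun x => Real.exp (-(lam * (x * F x / L x)))) atTop (𝓝 1) := by
    have := (hq.const_mul lam).neg.rexp
    simpa using this
  have hhigh : Tendsto (fun x => 1 + C * Real.Gamma (1 / 2) * lam ^ (-(1 / 2) : ℝ) *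
      (x * F x / L x) ^ (1 / 2 : ℝ)) atTop (𝓝 1) := by
    have h1 : Tendsto (fun x => (x * F x / L x) ^ (1 / 2 : ℝ)) atTop (𝓝 0) := by
      have := hq.rpow_const (p := (1 / 2 : ℝ)) (Or.inr (by norm_num))
      rwa [Real.zero_rpow (by norm_num)] at this
    simpa using (h1.const_mul (C * Real.Gamma (1 / 2) * lam ^ (-(1 / 2) : ℝ))).const_add 1
  -- With `r = lam * F x / L x`, the exponential lies between `exp (-(r * x))` and 1 on `[0, x]`,
  -- and `r * x → 0`. Beyond `x`, Potter gives `F u ≤ C * F x * (x / u) ^ (1 / 2)`, and the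
  -- resulting Gamma integral is `L x` times a multiple of `(x * F x / L x) ^ (1 / 2)`.
  refine tendsto_of_tendsto_of_tendsto_of_le_of_le' hlow hhigh ?_ ?_
  · filter_upwards [eventually_gt_atTop 0] with x hx
    have hLx : 0 < L x := integral_tail_pos hm hanti hnn hpos hle hx
    have hFx := hpos x hx
    set r := lam * F x / L x with hr
    have hr0 : 0 < r := by positivity
    rw [le_div_iff₀ hLx]
    have hsub : ∫ u in Ioc 0 x, Real.exp (-(r * u)) * F u ≤
        ∫ u in Ioi (0 : ℝ), Real.exp (-(r * u)) * F u := by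
      refine setIntegral_mono_set (integrableOn_exp_mul_tail hm hnn hle hr0)
        (Eventually.of_forall fun u => mul_nonneg (Real.exp_pos _).le (hnn u))
        (Ioc_subset_Ioi_self.eventuallyLE)
    refine le_trans ?_ hsub
    rw [hL]
    simp only
    rw [intervalIntegral.integral_of_le hx.le, ← integral_const_mul]
    refine setIntegral_mono_on ?_ ?_ measurableSet_Ioc ?_
    · exact ((intervalIntegrable_iff_integrableOn_Ioc_of_le hx.le).1
        (intervalIntegrable_tail hm hnn hle 0 x)).const_mul _
    · exact (integrableOn_exp_mul_tail hm hnn hle hr0).mono_set Ioc_subset_Ioi_self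
    · intro u hu
      refine mul_le_mul_of_nonneg_right (Real.exp_le_exp.2 ?_) (hnn u)
      have : lam * (x * F x / ∫ u in Ioc 0 x, F u) = r * x := by
        rw [hr, hL]; simp only; rw [intervalIntegral.integral_of_le hx.le]; ring
      rw [this]
      nlinarith [hu.2]
  · filter_upwards [eventually_ge_atTop x₀] with x hxx
    have hx : 0 < x := hx₀.trans_le hxx
    have hLx : 0 < L x := integral_tail_pos hm hanti hnn hpos hle hx
    have hFx := hpos x hx
    set r := lam * F x / L x with hr
    have hr0 : 0 < r := by positivity
    rw [div_le_iff₀ hLx, ← Ioc_union_Ioi_eq_Ioi hx.le,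
      setIntegral_union (Ioc_disjoint_Ioi le_rfl) measurableSet_Ioi
        ((integrableOn_exp_mul_tail hm hnn hle hr0).mono_set Ioc_subset_Ioi_self)
        ((integrableOn_exp_mul_tail hm hnn hle hr0).mono_set (Ioi_subset_Ioi hx.le)), add_mul,
      one_mul]
    refine add_le_add ?_ ?_
    · rw [hL]
      simp only
      rw [intervalIntegral.integral_of_le hx.le]
      refine setIntegral_mono_on
        ((integrableOn_exp_mul_tail hm hnn hle hr0).mono_set Ioc_subset_Ioi_self) ?_
        measurableSet_Ioc ?_
      · exact ((intervalIntegrable_iff_integrableOn_Ioc_of_le hx.le).1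
          (intervalIntegrable_tail hm hnn hle 0 x))
      · intro u hu
        refine mul_le_of_le_one_left (hnn u) (Real.exp_le_one_iff.2 ?_)
        nlinarith [hu.1]
    · have hint : IntegrableOn (fun u : ℝ => u ^ (-(1 / 2) : ℝ) * Real.exp (-(r * u)))
          (Ioi 0) := by
        have := integrableOn_rpow_mul_exp_neg_mul_rpow (s := -(1 / 2)) (by norm_num) one_pos hr0
        simpa only [Real.rpow_one, neg_mul] using this
      have hval := Real.integral_rpow_mul_exp_neg_mul_Ioi (a := 1 / 2) (by norm_num) hr0
      rw [show (1 / 2 - 1 : ℝ) = -(1 / 2) by norm_num] at hval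
      calc ∫ u in Ioi x, Real.exp (-(r * u)) * F u
          ≤ ∫ u in Ioi x, C * (F x * x ^ (1 / 2 : ℝ)) *
              (u ^ (-(1 / 2) : ℝ) * Real.exp (-(r * u))) := by
            refine setIntegral_mono_on
              ((integrableOn_exp_mul_tail hm hnn hle hr0).mono_set (Ioi_subset_Ioi hx.le))
              ((hint.mono_set (Ioi_subset_Ioi hx.le)).const_mul _) measurableSet_Ioi ?_
            intro u (hu : x < u)
            have hu0 : 0 < u := hx.trans hu
            have h1 := hpot x hxx u hu.le
            have h2 : F u ≤ C * (F x * x ^ (1 / 2 : ℝ)) * u ^ (-(1 / 2) : ℝ) := by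
              rw [Real.rpow_neg hu0.le, ← div_eq_mul_inv, le_div_iff₀ (by positivity)]
              exact h1
            calc _ ≤ Real.exp (-(r * u)) *
                (C * (F x * x ^ (1 / 2 : ℝ)) * u ^ (-(1 / 2) : ℝ)) := by gcongr
              _ = _ := by ring
        _ ≤ ∫ u in Ioi (0 : ℝ), C * (F x * x ^ (1 / 2 : ℝ)) *
              (u ^ (-(1 / 2) : ℝ) * Real.exp (-(r * u))) := by
            refine setIntegral_mono_set (hint.const_mul _) ?_ (Ioi_subset_Ioi hx.le).eventuallyLE
            refine (ae_restrict_iff' measurableSet_Ioi).2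
              (Eventually.of_forall fun u (hu : 0 < u) => ?_)
            simp only [Pi.zero_apply]
            positivity
        _ = C * (F x * x ^ (1 / 2 : ℝ)) * ((1 / r) ^ (1 / 2 : ℝ) * Real.Gamma (1 / 2)) := by
            rw [integral_const_mul, hval]
        _ = _ := by
            rw [hr, one_div_div, Real.div_rpow hLx.le (by positivity),
              Real.mul_rpow hlam.le hFx.le, Real.div_rpow (by positivity) hLx.le,
              Real.mul_rpow hx.le hFx.le, Real.rpow_neg hlam.le]
            have h1 : F x = F x ^ (1 / 2 : ℝ) * F x ^ (1 / 2 : ℝ) := by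
              rw [← Real.rpow_add hFx]; norm_num
            have h2 : L x = L x ^ (1 / 2 : ℝ) * L x ^ (1 / 2 : ℝ) := by
              rw [← Real.rpow_add hLx]; norm_num
            have h3 : 0 < F x ^ (1 / 2 : ℝ) := by positivity
            have h4 : 0 < L x ^ (1 / 2 : ℝ) := by positivity
            have h5 : 0 < lam ^ (1 / 2 : ℝ) := by positivity
            generalize F x ^ (1 / 2 : ℝ) = f at *
            generalize L x ^ (1 / 2 : ℝ) = l at *
            rw [h1, h2]
            field_simp

end IndexOne

lemma tendsto_one_div_atTop : Tendsto (fun t : ℝ => 1 / t) atTop (𝓝[>] 0) := by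
  simpa only [one_div] using tendsto_inv_atTop_nhdsGT_zero (𝕜 := ℝ)

/-! ### The distribution function, its inverse and `B` -/

section Mixing

variable {g : ℝ → ℝ}

lemma mixingLaw_Iic_of_nonpos {u : ℝ} (hu : u ≤ 0) : mixingLaw g (Iic u) = 0 := by
  rw [mixingLaw, withDensity_apply _ measurableSet_Iic, Measure.restrict_restrict measurableSet_Iic,
    (by ext x; simp; intro h; linarith : Iic u ∩ Ioi (0 : ℝ) = ∅)]
  simp

lemma ae_mixingLaw_pos : ∀ᵐ w ∂(mixingLaw g), 0 < w := by
  have := mixingLaw_Iic_of_nonpos (g := g) le_rfl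
  rw [ae_iff]
  simpa [not_lt, Iic_def] using this

lemma mixingLaw_singleton (u : ℝ) : mixingLaw g {u} = 0 := by
  have : mixingLaw g ≪ volume :=
    (withDensity_absolutelyContinuous _ _).trans Measure.restrict_le_self.absolutelyContinuous
  exact this (by simp)

lemma mixingLaw_Ioc_ne_zero (hg_cont : ContinuousOn g (Ioi 0)) (hg_pos : ∀ w : ℝ, 0 < w → 0 < g w)
    {a b : ℝ} (ha : 0 ≤ a) (hab : a < b) : mixingLaw g (Ioc a b) ≠ 0 := by
  have hsub : Ioc a b ⊆ Ioi 0 := fun x hx => ha.trans_lt hx.1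
  have hm : AEMeasurable (fun w => ENNReal.ofReal (g w)) (volume.restrict (Ioi 0)) :=
    (hg_cont.aemeasurable measurableSet_Ioi).ennreal_ofReal
  rw [mixingLaw, Ne, withDensity_apply_eq_zero' hm, Measure.restrict_apply' measurableSet_Ioi]
  intro h
  have h1 : Ioc a b ⊆ ({x | ENNReal.ofReal (g x) ≠ 0} ∩ Ioc a b) ∩ Ioi 0 := by
    intro x hx
    refine ⟨⟨?_, hx⟩, hsub hx⟩
    simpa using hg_pos x (hsub hx)
  have h2 := measure_mono_null h1 h
  simp at h2
  linarith

lemma G_nonneg (u : ℝ) : 0 ≤ G g u := cdf_nonneg _ _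

lemma G_le_one (u : ℝ) : G g u ≤ 1 := cdf_le_one _ _

lemma monotone_G : Monotone (G g) := monotone_cdf _

variable [IsProbabilityMeasure (mixingLaw g)]

lemma G_eq_real (u : ℝ) : G g u = (mixingLaw g).real (Iic u) := cdf_eq_real _ _

lemma G_zero : G g 0 = 0 := by
  rw [G_eq_real, Measure.real, mixingLaw_Iic_of_nonpos le_rfl]; rfl

/-- The law has no atoms, so the distribution function has no jumps. -/
lemma continuous_G : Continuous (G g) := by
  rw [continuous_iff_continuousAt]
  intro u
  have h1 : ((cdf (mixingLaw g)).measure) {u} = 0 := by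
    rw [measure_cdf]; exact mixingLaw_singleton u
  rw [StieltjesFunction.measure_singleton, ENNReal.ofReal_eq_zero] at h1
  have h2 := (monotone_cdf (mixingLaw g)).leftLim_le (le_refl u)
  change ContinuousAt (cdf (mixingLaw g)) u
  rw [(monotone_cdf (mixingLaw g)).continuousAt_iff_leftLim_eq_rightLim,
    StieltjesFunction.rightLim_eq]
  linarith

lemma strictMonoOn_G (hg_cont : ContinuousOn g (Ioi 0)) (hg_pos : ∀ w : ℝ, 0 < w → 0 < g w) :
    StrictMonoOn (G g) (Ici 0) := by
  intro a ha b hb hab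
  have h := mixingLaw_Ioc_ne_zero hg_cont hg_pos ha hab
  have h1 : (mixingLaw g).real (Ioc a b) = G g b - G g a := by
    rw [G_eq_real, G_eq_real, show Ioc a b = Iic b \ Iic a by ext x; simp [and_comm],
      measureReal_sdiff (Iic_subset_Iic.2 hab.le) measurableSet_Iic]
  have h2 : 0 < (mixingLaw g).real (Ioc a b) :=
    ENNReal.toReal_pos h (measure_ne_top _ _)
  linarith

lemma exists_G_eq {y : ℝ} (hy0 : 0 ≤ y) (hy1 : y < 1) : ∃ u ∈ Ici (0 : ℝ), G g u = y := by
  have h1 : Tendsto (G g) atTop (𝓝 1) := tendsto_cdf_atTop _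
  obtain ⟨b, hb, hb0⟩ := ((h1.eventually (lt_mem_nhds hy1)).and (eventually_ge_atTop 0)).exists
  obtain ⟨u, hu, hGu⟩ := intermediate_value_Icc hb0 continuous_G.continuousOn
    (⟨by rwa [G_zero], hb.le⟩ : y ∈ Icc (G g 0) (G g b))
  exact ⟨u, hu.1, hGu⟩

lemma H_nonneg {y : ℝ} (hy0 : 0 ≤ y) (hy1 : y < 1) : 0 ≤ H g y :=
  Function.invFunOn_mem (exists_G_eq hy0 hy1)

lemma G_H {y : ℝ} (hy0 : 0 ≤ y) (hy1 : y < 1) : G g (H g y) = y :=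
  Function.invFunOn_eq (exists_G_eq hy0 hy1)

lemma H_pos {y : ℝ} (hy0 : 0 < y) (hy1 : y < 1) : 0 < H g y := by
  refine (H_nonneg hy0.le hy1).lt_of_ne fun h => ?_
  have := G_H hy0.le hy1 (g := g)
  rw [← h, G_zero] at this
  exact hy0.ne this

lemma tendsto_H (hg_cont : ContinuousOn g (Ioi 0)) (hg_pos : ∀ w : ℝ, 0 < w → 0 < g w) :
    Tendsto (H g) (𝓝[>] 0) (𝓝[>] 0) := by
  have hmono := strictMonoOn_G hg_cont hg_pos
  have hlt1 : ∀ᶠ y : ℝ in 𝓝[>] 0, y < 1 := nhdsWithin_le_nhds (gt_mem_nhds one_pos)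
  refine tendsto_nhdsWithin_iff.2 ⟨?_, ?_⟩
  · refine tendsto_order.2 ⟨fun a ha => ?_, fun a ha => ?_⟩
    · filter_upwards [self_mem_nhdsWithin, hlt1] with y hy hy1
      exact ha.trans (H_pos hy hy1)
    · have : 0 < G g a := by
        rw [← G_zero (g := g)]; exact hmono (mem_Ici.2 le_rfl) ha.le ha
      filter_upwards [self_mem_nhdsWithin, hlt1,
        nhdsWithin_le_nhds (gt_mem_nhds this)] with y hy hy1 hya
      by_contra! hcon
      have := monotone_G (g := g) hcon
      rw [G_H (le_of_lt hy) hy1] at this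
      linarith
  · filter_upwards [self_mem_nhdsWithin, hlt1] with y hy hy1 using H_pos hy hy1

/-- The inverse of a function regularly varying at `0` is regularly varying at `0`. -/
lemma tendsto_H_mul_div (hg_cont : ContinuousOn g (Ioi 0)) (hg_pos : ∀ w : ℝ, 0 < w → 0 < g w)
    {β : ℝ} (hβ : 0 < β) (hG : RegVarAt (G g) (𝓝[>] 0) β) {s : ℝ} (hs : 0 < s) :
    Tendsto (fun y => H g (s * y) / H g y) (𝓝[>] 0) (𝓝 (s ^ (1 / β))) := by
  have hH := tendsto_H hg_cont hg_pos
  have hlt1 : ∀ᶠ y : ℝ in 𝓝[>] 0, y < 1 := nhdsWithin_le_nhds (gt_mem_nhds one_pos)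
  have hlt2 : ∀ᶠ y : ℝ in 𝓝[>] 0, s * y < 1 := by
    filter_upwards [nhdsWithin_le_nhds (gt_mem_nhds (inv_pos.2 hs))] with y hy
    rw [← mul_inv_cancel₀ hs.ne']; gcongr
  have hsβ : (s ^ (1 / β)) ^ β = s := by
    rw [← Real.rpow_mul hs.le]; simp [hβ.ne']
  -- Compare `H (s * y)` with `c * H y` by applying `G`: the values are `s * y` and asymptotically
  -- `c ^ β * y`, so the order is decided by `c` against `s ^ (1 / β)`.
  refine tendsto_order.2 ⟨fun c hc => ?_, fun c hc => ?_⟩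
  · rcases le_or_gt c 0 with hc0 | hc0
    · filter_upwards [hlt1, hlt2, self_mem_nhdsWithin] with y h1 h2 (h3 : 0 < y)
      exact hc0.trans_lt (div_pos (H_pos (by positivity) h2) (H_pos h3 h1))
    · have hcs : c ^ β < s := by
        rw [← hsβ]; exact Real.rpow_lt_rpow hc0.le hc hβ
      filter_upwards [((hG.2 c hc0).comp hH).eventually (gt_mem_nhds hcs), hlt1, hlt2,
        self_mem_nhdsWithin] with y h0 h1 h2 (h3 : 0 < y)
      simp only [Function.comp_apply] at h0
      rw [G_H h3.le h1, div_lt_iff₀ h3] at h0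
      rw [lt_div_iff₀ (H_pos h3 h1)]
      by_contra! hcon
      have := monotone_G (g := g) hcon
      rw [G_H (by positivity) h2] at this
      linarith
  · have hc0 : 0 < c := lt_trans (by positivity) hc
    have hcs : s < c ^ β := by
      rw [← hsβ]; exact Real.rpow_lt_rpow (by positivity) hc hβ
    filter_upwards [((hG.2 c hc0).comp hH).eventually (lt_mem_nhds hcs), hlt1, hlt2,
      self_mem_nhdsWithin] with y h0 h1 h2 (h3 : 0 < y)
    simp only [Function.comp_apply] at h0
    rw [G_H h3.le h1, lt_div_iff₀ h3] at h0
    rw [div_lt_iff₀ (H_pos h3 h1)]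
    by_contra! hcon
    have := monotone_G (g := g) hcon
    rw [G_H (by positivity) h2] at this
    linarith

lemma B_pos {t : ℝ} (ht : 1 < t) : 0 < B g t := by
  have : 1 / t < 1 := by rw [div_lt_one (by linarith)]; exact ht
  exact one_div_pos.2 (H_pos (by positivity) this)

lemma tendsto_B (hg_cont : ContinuousOn g (Ioi 0)) (hg_pos : ∀ w : ℝ, 0 < w → 0 < g w) :
    Tendsto (B g) atTop atTop := by
  have := (tendsto_inv_nhdsGT_zero (𝕜 := ℝ)).comp
    ((tendsto_H hg_cont hg_pos).comp tendsto_one_div_atTop)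
  refine this.congr fun t => ?_
  simp [B]

lemma G_one_div_B {t : ℝ} (ht : 1 < t) : G g (1 / B g t) = 1 / t := by
  have : 1 / t < 1 := by rw [div_lt_one (by linarith)]; exact ht
  rw [B, one_div_one_div, G_H (by positivity) this]

lemma regVarAt_B (hg_cont : ContinuousOn g (Ioi 0)) (hg_pos : ∀ w : ℝ, 0 < w → 0 < g w)
    {β : ℝ} (hβ : 0 < β) (hG : RegVarAt (G g) (𝓝[>] 0) β) :
    RegVarAt (B g) atTop (1 / β) := by
  refine ⟨(eventually_gt_atTop 1).mono fun t ht => B_pos ht, fun s hs => ?_⟩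
  have h := (tendsto_H_mul_div hg_cont hg_pos hβ hG (inv_pos.2 hs)).inv₀ (by positivity)
  rw [← Real.inv_rpow (by positivity), inv_inv] at h
  refine (h.comp tendsto_one_div_atTop).congr fun t => ?_
  simp only [Function.comp_apply, B, inv_div]
  rw [show s⁻¹ * (1 / t) = 1 / (s * t) by field_simp]
  rw [div_div_div_eq, one_mul, mul_one]

end Mixing

/-! ### The tail of the precision, regular variation of `A`, and the Laplace transform -/

section Tail

variable {g : ℝ → ℝ}

lemma measurable_tail : Measurable fun u : ℝ => G g (1 / u) :=
  (monotone_G (g := g)).measurable.comp (measurable_const.div measurable_id)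

lemma antitoneOn_tail : AntitoneOn (fun u : ℝ => G g (1 / u)) (Ioi 0) := fun _ ha _ _ hab =>
  monotone_G (one_div_le_one_div_of_le ha hab)

lemma tail_pos [IsProbabilityMeasure (mixingLaw g)] (hg_cont : ContinuousOn g (Ioi 0))
    (hg_pos : ∀ w : ℝ, 0 < w → 0 < g w) (u : ℝ) (hu : 0 < u) : 0 < G g (1 / u) := by
  rw [← G_zero (g := g)]
  exact strictMonoOn_G hg_cont hg_pos (mem_Ici.2 le_rfl) (mem_Ici.2 (by positivity))
    (by positivity)

lemma tendsto_tail_mul_div {β : ℝ} (hG : RegVarAt (G g) (𝓝[>] 0) β) (s : ℝ) (hs : 0 < s) :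
    Tendsto (fun u : ℝ => G g (1 / (s * u)) / G g (1 / u)) atTop (𝓝 (s ^ (-β))) := by
  have h := (hG.2 s⁻¹ (inv_pos.2 hs)).comp tendsto_one_div_atTop
  rw [Real.inv_rpow hs.le, ← Real.rpow_neg hs.le] at h
  refine h.congr fun t => ?_
  simp only [Function.comp_apply]
  rw [show s⁻¹ * (1 / t) = 1 / (s * t) by field_simp]

variable [IsProbabilityMeasure (mixingLaw g)]

/-- The truncated mean is slowly varying and stays so along `B`, leaving only the factor `t` to
contribute to the index. -/
lemma regVarAt_A (hg_cont : ContinuousOn g (Ioi 0)) (hg_pos : ∀ w : ℝ, 0 < w → 0 < g w)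
    (hG : RegVarAt (G g) (𝓝[>] 0) 1) : RegVarAt (A g) atTop 1 := by
  have hpos := tail_pos hg_cont hg_pos
  have hLpos : ∀ x : ℝ, 0 < x → 0 < ∫ u in (0 : ℝ)..x, G g (1 / u) := fun x hx =>
    integral_tail_pos measurable_tail antitoneOn_tail (fun _ => G_nonneg _) hpos
      (fun _ => G_le_one _) hx
  have hLmono := integral_tail_mono (F := fun u : ℝ => G g (1 / u)) measurable_tail
    (fun _ => G_nonneg _) (fun _ => G_le_one _)
  have hslow : ∀ c : ℝ, 0 < c → Tendsto (fun t => (∫ u in (0 : ℝ)..c * B g t, G g (1 / u)) /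
      ∫ u in (0 : ℝ)..B g t, G g (1 / u)) atTop (𝓝 1) := fun c hc =>
    (tendsto_integral_tail_mul_div measurable_tail antitoneOn_tail (fun _ => G_nonneg _) hpos
      (fun _ => G_le_one _) (tendsto_tail_mul_div hG) hc).comp (tendsto_B hg_cont hg_pos)
  refine ⟨(eventually_gt_atTop 1).mono fun t ht =>
    mul_pos (by linarith) (hLpos _ (B_pos ht)), fun s hs => ?_⟩
  have hB := (regVarAt_B hg_cont hg_pos one_pos hG).2 s hs
  rw [div_one, Real.rpow_one] at hB
  have hratio : Tendsto (fun t => (∫ u in (0 : ℝ)..B g (s * t), G g (1 / u)) /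
      ∫ u in (0 : ℝ)..B g t, G g (1 / u)) atTop (𝓝 1) := by
    -- `B (s * t)` is eventually between `(s / 2) * B t` and `2 * s * B t`; monotonicity of the
    -- integral then avoids any uniform convergence theorem.
    refine tendsto_of_tendsto_of_tendsto_of_le_of_le' (hslow (s / 2) (by positivity))
      (hslow (2 * s) (by positivity)) ?_ ?_
    · filter_upwards [hB.eventually (lt_mem_nhds (half_lt_self hs)), eventually_gt_atTop 1]
        with t h1 ht
      have hBt := B_pos (g := g) ht
      rw [lt_div_iff₀ hBt] at h1
      exact div_le_div_of_nonneg_right (hLmono h1.le) (hLpos _ hBt).le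
    · filter_upwards [hB.eventually (gt_mem_nhds (show s < 2 * s by linarith)),
        eventually_gt_atTop 1] with t h1 ht
      have hBt := B_pos (g := g) ht
      rw [div_lt_iff₀ hBt] at h1
      exact div_le_div_of_nonneg_right (hLmono h1.le) (hLpos _ hBt).le
  have := hratio.const_mul s
  rw [mul_one] at this
  rw [Real.rpow_one]
  refine this.congr' ?_
  filter_upwards [eventually_gt_atTop 1] with t ht
  have := hLpos _ (B_pos (g := g) ht)
  rw [A, A]
  field_simp

/-- The Laplace transform of `1 / W`, expressed by the tail of `1 / W`. -/
lemma one_sub_laplace {r : ℝ} (hr : 0 < r) :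
    1 - ∫ w, Real.exp (-(r * (1 / w))) ∂(mixingLaw g) =
      r * ∫ u in Ioi (0 : ℝ), Real.exp (-(r * u)) * G g (1 / u) := by
  have hprim : ∀ x : ℝ, ∫ t in (0 : ℝ)..x, r * Real.exp (-(r * t)) = 1 - Real.exp (-(r * x)) := by
    intro x
    have hd : ∀ t ∈ uIcc 0 x, HasDerivAt (fun t => -Real.exp (-(r * t)))
        (r * Real.exp (-(r * t))) t := by
      intro t _
      have := ((hasDerivAt_const_mul r (x := t)).fun_neg.exp).fun_neg
      convert! this using 1
      ring
    rw [intervalIntegral.integral_eq_sub_of_hasDerivAt hd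
      (Continuous.intervalIntegrable (by fun_prop) _ _)]
    simp; ring
  have hint : Integrable (fun w : ℝ => Real.exp (-(r * (1 / w)))) (mixingLaw g) := by
    refine (integrable_const (1 : ℝ)).mono' (by fun_prop) ?_
    filter_upwards [ae_mixingLaw_pos] with w hw
    rw [Real.norm_of_nonneg (Real.exp_pos _).le]
    exact Real.exp_le_one_iff.2 (by rw [neg_nonpos]; positivity)
  have hpos : 0 ≤ᵐ[mixingLaw g] fun w : ℝ => 1 / w := by
    filter_upwards [ae_mixingLaw_pos] with w hw using by simp [hw.le]
  -- Layer-cake formula for the function `x ↦ 1 - exp (-(r * x))` of the precision `1 / w`, whose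
  -- derivative is `r * exp (-(r * t))`.
  have hlayer := lintegral_comp_eq_lintegral_meas_lt_mul (mixingLaw g) hpos
    (by fun_prop) (g := fun t => r * Real.exp (-(r * t)))
    (fun t _ => Continuous.intervalIntegrable (by fun_prop) _ _)
    (Eventually.of_forall fun t => by positivity)
  have hmeas : ∀ t ∈ Ioi (0 : ℝ), mixingLaw g {a | t < 1 / a} * ENNReal.ofReal
      (r * Real.exp (-(r * t))) = ENNReal.ofReal (r * (Real.exp (-(r * t)) * G g (1 / t))) := by
    intro t (ht : 0 < t)
    have h1 : mixingLaw g {a | t < 1 / a} = mixingLaw g (Iic (1 / t)) := by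
      refine measure_congr ?_
      have hne : ∀ᵐ w ∂(mixingLaw g), w ≠ 1 / t := by
        rw [ae_iff]; simpa using mixingLaw_singleton (g := g) t⁻¹
      filter_upwards [ae_mixingLaw_pos, hne] with w hw hw2
      refine propext ?_
      change t < 1 / w ↔ w ≤ 1 / t
      rw [lt_one_div ht hw]
      exact ⟨le_of_lt, fun h => lt_of_le_of_ne h hw2⟩
    rw [h1, G_eq_real, ← ofReal_measureReal, ← ENNReal.ofReal_mul measureReal_nonneg]
    congr 1; ring
  rw [setLIntegral_congr_fun measurableSet_Ioi hmeas] at hlayer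
  simp only [hprim] at hlayer
  have h1 : 1 - ∫ w, Real.exp (-(r * (1 / w))) ∂(mixingLaw g) =
      ∫ w, (1 - Real.exp (-(r * (1 / w)))) ∂(mixingLaw g) := by
    rw [integral_sub (integrable_const _) hint]; simp
  rw [h1, ← integral_const_mul, integral_eq_lintegral_of_nonneg_ae ?_ (by fun_prop), hlayer,
    integral_eq_lintegral_of_nonneg_ae (Eventually.of_forall fun t =>
      mul_nonneg hr.le (mul_nonneg (Real.exp_pos _).le (G_nonneg _))) ?_]
  · exact (((by fun_prop : Measurable fun t : ℝ => Real.exp (-(r * t))).mul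
      measurable_tail).const_mul r).aestronglyMeasurable
  · filter_upwards [ae_mixingLaw_pos] with w hw
    simp only [Pi.zero_apply, sub_nonneg, Real.exp_le_one_iff, neg_nonpos]
    positivity

end Tail

/-! ### From Laplace transforms to laws -/

lemma exp_neg_mem_Icc {u : ℝ} (hu : 0 ≤ u) : Real.exp (-u) ∈ Icc (0 : ℝ) 1 :=
  ⟨(Real.exp_pos _).le, Real.exp_le_one_iff.2 (by linarith)⟩

lemma integrable_comp_exp_neg {ν : Measure ℝ} [IsProbabilityMeasure ν] (hν : ∀ᵐ u ∂ν, 0 ≤ u)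
    {f : ℝ → ℝ} (hf : ContinuousOn f (Icc 0 1)) (hfm : Measurable f) :
    Integrable (fun u => f (Real.exp (-u))) ν := by
  obtain ⟨C, hC⟩ := isCompact_Icc.exists_bound_of_continuousOn hf
  refine (integrable_const C).mono' (hfm.comp (by fun_prop)).aestronglyMeasurable ?_
  filter_upwards [hν] with u hu using hC _ (exp_neg_mem_Icc hu)

/-- Convergence of Laplace transforms implies convergence of the integrals of all continuous
functions on the one-point compactification of `[0, ∞)`. -/
lemma tendsto_integral_comp_exp_neg {νs : ℕ → Measure ℝ} [∀ n, IsProbabilityMeasure (νs n)]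
    {ν : Measure ℝ} [IsProbabilityMeasure ν] (hνs : ∀ n, ∀ᵐ u ∂νs n, 0 ≤ u)
    (hν : ∀ᵐ u ∂ν, 0 ≤ u)
    (h : ∀ lam : ℝ, 0 < lam → Tendsto (fun n => ∫ u, Real.exp (-(lam * u)) ∂νs n) atTop
      (𝓝 (∫ u, Real.exp (-(lam * u)) ∂ν)))
    {f : ℝ → ℝ} (hf : ContinuousOn f (Icc 0 1)) (hfm : Measurable f) :
    Tendsto (fun n => ∫ u, f (Real.exp (-u)) ∂νs n) atTop (𝓝 (∫ u, f (Real.exp (-u)) ∂ν)) := by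
  have hpint : ∀ (p : Polynomial ℝ) (ρ : Measure ℝ) [IsProbabilityMeasure ρ],
      (∀ᵐ u ∂ρ, 0 ≤ u) → Integrable (fun u => p.eval (Real.exp (-u))) ρ := fun p ρ _ hρ =>
    integrable_comp_exp_neg hρ p.continuous.continuousOn p.continuous.measurable
  have hpoly : ∀ p : Polynomial ℝ,
      Tendsto (fun n => ∫ u, p.eval (Real.exp (-u)) ∂νs n) atTop
        (𝓝 (∫ u, p.eval (Real.exp (-u)) ∂ν)) := by
    -- A monomial in `exp (-u)` is a Laplace kernel at an integer `k`; `k = 0` only uses total mass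
    -- one.
    intro p
    induction p using Polynomial.induction_on' with
    | add p q hp hq =>
      simp only [Polynomial.eval_add]
      rw [integral_add (hpint p ν hν) (hpint q ν hν)]
      refine (hp.add hq).congr fun n => ?_
      rw [integral_add (hpint p _ (hνs n)) (hpint q _ (hνs n))]
    | monomial k a =>
      simp only [Polynomial.eval_monomial, integral_const_mul]
      refine Tendsto.const_mul a ?_
      rcases Nat.eq_zero_or_pos k with rfl | hk
      · simp
      · have := h k (by exact_mod_cast hk)
        simpa only [← Real.exp_nat_mul, mul_neg] using this
  have happrox : ∀ (ε : ℝ) (p : Polynomial ℝ), (∀ x ∈ Icc (0 : ℝ) 1, |p.eval x - f x| < ε) →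
      ∀ (ρ : Measure ℝ) [IsProbabilityMeasure ρ], (∀ᵐ u ∂ρ, 0 ≤ u) →
      |∫ u, p.eval (Real.exp (-u)) ∂ρ - ∫ u, f (Real.exp (-u)) ∂ρ| ≤ ε := by
    intro ε p hp ρ _ hρ
    rw [← integral_sub (hpint p ρ hρ) (integrable_comp_exp_neg hρ hf hfm)]
    have := norm_integral_le_of_norm_le_const (μ := ρ) (C := ε)
      (f := fun u => p.eval (Real.exp (-u)) - f (Real.exp (-u))) (by
        filter_upwards [hρ] with u hu using (hp _ (exp_neg_mem_Icc hu)).le)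
    simpa using this
  refine Metric.tendsto_nhds.2 fun ε hε => ?_
  obtain ⟨p, hp⟩ := exists_polynomial_near_of_continuousOn 0 1 f hf (ε / 3) (by positivity)
  filter_upwards [Metric.tendsto_nhds.1 (hpoly p) (ε / 3) (by positivity)] with n hn
  have h1 := happrox _ p hp (νs n) (hνs n)
  have h2 := happrox _ p hp ν hν
  rw [Real.dist_eq] at hn ⊢
  rw [abs_lt] at hn ⊢
  rw [abs_le] at h1 h2
  constructor <;> linarith

/-- A pointwise limit of Laplace transforms that tends to `1` at `0` and to `0` at infinity is the
Laplace transform of a law on `(0, ∞)`. -/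
lemma exists_measure_of_tendsto_laplace {νs : ℕ → Measure ℝ} [∀ n, IsProbabilityMeasure (νs n)]
    (hνs : ∀ n, ∀ᵐ u ∂νs n, 0 ≤ u) {Φ : ℝ → ℝ}
    (h : ∀ lam : ℝ, 0 < lam → Tendsto (fun n => ∫ u, Real.exp (-(lam * u)) ∂νs n) atTop
      (𝓝 (Φ lam)))
    (h0 : Tendsto Φ (𝓝[>] 0) (𝓝 1)) (hinf : Tendsto Φ atTop (𝓝 0)) :
    ∃ ν : Measure ℝ, IsProbabilityMeasure ν ∧ (∀ᵐ u ∂ν, 0 < u) ∧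
      ∀ lam : ℝ, 0 < lam → ∫ u, Real.exp (-(lam * u)) ∂ν = Φ lam := by
  set e : ℝ → Icc (0 : ℝ) 1 := fun u => projIcc 0 1 zero_le_one (Real.exp (-u)) with he
  have hem : Measurable e := (continuous_projIcc.comp (by fun_prop)).measurable
  -- Images under `u ↦ exp (-u)` live on a compact space, so they converge along an ultrafilter; the
  -- hypothesis on Laplace transforms identifies the moments of the limit.
  set ρ : ℕ → ProbabilityMeasure (Icc (0 : ℝ) 1) := fun n =>
    ⟨(νs n).map e, Measure.isProbabilityMeasure_map hem.aemeasurable⟩ with hρ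
  set U : Ultrafilter ℕ := Ultrafilter.of atTop
  set ρ₀ : ProbabilityMeasure (Icc (0 : ℝ) 1) := (U.map ρ).lim with hρ₀
  have hconv : Tendsto ρ U (𝓝 ρ₀) := (U.map ρ).le_nhds_lim
  have hcont : ∀ lam : ℝ, 0 < lam → Continuous fun y : Icc (0 : ℝ) 1 => (y : ℝ) ^ lam :=
    fun lam hlam => continuous_subtype_val.rpow_const fun _ => Or.inr hlam.le
  have hlap : ∀ lam : ℝ, 0 < lam → ∫ y : Icc (0 : ℝ) 1, (y : ℝ) ^ lam ∂(ρ₀ : Measure _) =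
      Φ lam := by
    intro lam hlam
    have h1 : Tendsto (fun n => ∫ y : Icc (0 : ℝ) 1, (y : ℝ) ^ lam ∂(ρ n : Measure _)) U
        (𝓝 (∫ y : Icc (0 : ℝ) 1, (y : ℝ) ^ lam ∂(ρ₀ : Measure _))) :=
      (ProbabilityMeasure.tendsto_iff_forall_integral_tendsto.1 hconv)
        (BoundedContinuousFunction.mkOfCompact ⟨_, hcont lam hlam⟩)
    refine tendsto_nhds_unique h1 (((h lam hlam).mono_left (Ultrafilter.of_le _)).congr fun n => ?_)
    simp only [hρ, ProbabilityMeasure.coe_mk]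
    rw [integral_map hem.aemeasurable (hcont lam hlam).aestronglyMeasurable]
    refine integral_congr_ae ?_
    filter_upwards [hνs n] with u hu
    rw [he]
    simp only
    rw [projIcc_of_mem _ (exp_neg_mem_Icc hu), ← Real.exp_mul]
    congr 1; ring
  have hbound : ∀ lam : ℝ, 0 < lam → ∀ y : Icc (0 : ℝ) 1, ‖(y : ℝ) ^ lam‖ ≤ 1 := by
    intro lam hlam y
    rw [Real.norm_of_nonneg (Real.rpow_nonneg y.2.1 _)]
    exact Real.rpow_le_one y.2.1 y.2.2 hlam.le
  have hk : ∀ k : ℕ, (0 : ℝ) < k + 1 := fun k => by positivity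
  have hktop : Tendsto (fun k : ℕ => (k : ℝ) + 1) atTop atTop :=
    tendsto_atTop_add_const_right _ _ tendsto_natCast_atTop_atTop
  -- No mass escapes to `u = ∞`, that is `y = 0`: small powers of `y` tend to the indicator of `y ≠
  -- 0`, and `Φ → 1` at 0.
  have hzero : ∀ᵐ y : Icc (0 : ℝ) 1 ∂(ρ₀ : Measure (Icc (0 : ℝ) 1)), (y : ℝ) ≠ 0 := by
    set s : Set (Icc (0 : ℝ) 1) := {y | (y : ℝ) ≠ 0} with hs
    have hsm : MeasurableSet s := measurable_subtype_coe (measurableSet_singleton 0).compl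
    have h1 : Tendsto (fun k : ℕ => ∫ y : Icc (0 : ℝ) 1, (y : ℝ) ^ (1 / ((k : ℝ) + 1))
        ∂(ρ₀ : Measure _)) atTop (𝓝 (∫ y, s.indicator (1 : Icc (0 : ℝ) 1 → ℝ) y ∂(ρ₀ : Measure _))) := by
      refine tendsto_integral_of_dominated_convergence (fun _ => 1)
        (fun k => (hcont _ (one_div_pos.2 (hk k))).aestronglyMeasurable) (integrable_const _)
        (fun k => Eventually.of_forall (hbound _ (one_div_pos.2 (hk k))))
        (Eventually.of_forall fun y => ?_)
      by_cases hy : (y : ℝ) = 0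
      · have : y ∉ s := fun hys => hys hy
        rw [indicator_of_notMem this]
        refine tendsto_const_nhds.congr fun k => ?_
        rw [hy, Real.zero_rpow (one_div_pos.2 (hk k)).ne']
      · have hys : y ∈ s := hy
        rw [indicator_of_mem hys]
        have := (Real.continuousAt_const_rpow (b := 0) hy).tendsto.comp
          (tendsto_one_div_add_atTop_nhds_zero_nat (𝕜 := ℝ))
        rwa [Real.rpow_zero] at this
    have h2 : Tendsto (fun k : ℕ => ∫ y : Icc (0 : ℝ) 1, (y : ℝ) ^ (1 / ((k : ℝ) + 1))
        ∂(ρ₀ : Measure _)) atTop (𝓝 1) := by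
      refine (h0.comp (tendsto_one_div_atTop.comp hktop)).congr fun k => ?_
      exact (hlap _ (one_div_pos.2 (hk k))).symm
    have h3 := tendsto_nhds_unique h1 h2
    rw [integral_indicator_one hsm] at h3
    rw [Measure.real, ENNReal.toReal_eq_one_iff] at h3
    exact (mem_ae_iff_prob_eq_one hsm).2 h3
  -- No mass sits at `u = 0`, that is `y = 1`: high powers of `y` tend to the indicator of `y = 1`,
  -- and `Φ → 0` at infinity.
  have hone : ∀ᵐ y : Icc (0 : ℝ) 1 ∂(ρ₀ : Measure (Icc (0 : ℝ) 1)), (y : ℝ) ≠ 1 := by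
    set s : Set (Icc (0 : ℝ) 1) := {y | (y : ℝ) = 1} with hs
    have hsm : MeasurableSet s := measurable_subtype_coe (measurableSet_singleton 1)
    have h1 : Tendsto (fun k : ℕ => ∫ y : Icc (0 : ℝ) 1, (y : ℝ) ^ ((k : ℝ) + 1)
        ∂(ρ₀ : Measure _)) atTop (𝓝 (∫ y, s.indicator (1 : Icc (0 : ℝ) 1 → ℝ) y ∂(ρ₀ : Measure _))) := by
      refine tendsto_integral_of_dominated_convergence (fun _ => 1)
        (fun k => (hcont _ (hk k)).aestronglyMeasurable) (integrable_const _)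
        (fun k => Eventually.of_forall (hbound _ (hk k)))
        (Eventually.of_forall fun y => ?_)
      by_cases hy : (y : ℝ) = 1
      · have hys : y ∈ s := hy
        rw [indicator_of_mem hys]
        refine tendsto_const_nhds.congr fun k => ?_
        rw [hy, Real.one_rpow, Pi.one_apply]
      · have : y ∉ s := hy
        rw [indicator_of_notMem this]
        have h3 := (tendsto_pow_atTop_nhds_zero_of_lt_one y.2.1
          (lt_of_le_of_ne y.2.2 hy)).comp (tendsto_add_atTop_nat 1)
        refine h3.congr fun k => ?_
        simp only [Function.comp_apply]
        rw [← Real.rpow_natCast]; push_cast; rfl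
    have h2 : Tendsto (fun k : ℕ => ∫ y : Icc (0 : ℝ) 1, (y : ℝ) ^ ((k : ℝ) + 1)
        ∂(ρ₀ : Measure _)) atTop (𝓝 0) := by
      refine (hinf.comp hktop).congr fun k => (hlap _ (hk k)).symm
    have h3 := tendsto_nhds_unique h1 h2
    rw [integral_indicator_one hsm, measureReal_eq_zero_iff] at h3
    exact measure_eq_zero_iff_ae_notMem.1 h3
  have hlogm : Measurable fun y : Icc (0 : ℝ) 1 => -Real.log y := by fun_prop
  refine ⟨(ρ₀ : Measure (Icc (0 : ℝ) 1)).map (fun y : Icc (0 : ℝ) 1 => -Real.log y),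
    Measure.isProbabilityMeasure_map hlogm.aemeasurable, ?_, fun lam hlam => ?_⟩
  · rw [ae_map_iff hlogm.aemeasurable measurableSet_Ioi]
    filter_upwards [hzero, hone] with y hy0 hy1
    have := Real.log_neg (lt_of_le_of_ne y.2.1 hy0.symm) (lt_of_le_of_ne y.2.2 hy1)
    linarith
  · rw [integral_map hlogm.aemeasurable (by fun_prop), ← hlap lam hlam]
    refine integral_congr_ae ?_
    filter_upwards [hzero] with y hy0
    rw [Real.rpow_def_of_pos (lt_of_le_of_ne y.2.1 hy0.symm)]
    congr 1; ring

lemma measurable_exp_neg_div (a : ℝ) : Measurable fun u : ℝ => Real.exp (-(a / u)) := by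
  fun_prop

/-- Convergence of Laplace transforms implies convergence of the integrals of `exp (-a / u)`. -/
lemma tendsto_integral_exp_neg_div {νs : ℕ → Measure ℝ} [∀ n, IsProbabilityMeasure (νs n)]
    {ν : Measure ℝ} [IsProbabilityMeasure ν] (hνs : ∀ n, ∀ᵐ u ∂νs n, 0 ≤ u)
    (hνs' : ∀ᶠ n in atTop, ∀ᵐ u ∂νs n, 0 < u) (hν : ∀ᵐ u ∂ν, 0 < u)
    (h : ∀ lam : ℝ, 0 < lam → Tendsto (fun n => ∫ u, Real.exp (-(lam * u)) ∂νs n) atTop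
      (𝓝 (∫ u, Real.exp (-(lam * u)) ∂ν))) {a : ℝ} (ha : 0 < a) :
    Tendsto (fun n => ∫ u, Real.exp (-(a / u)) ∂νs n) atTop
      (𝓝 (∫ u, Real.exp (-(a / u)) ∂ν)) := by
  classical
  -- This is `exp (-(a / u))` in the variable `y = exp (-u)`, extended continuously: 0 at `y = 1`
  -- (`u = 0`), and 1 at `y = 0` (`u = ∞`), the latter because `Real.log 0 = 0` and division by zero
  -- gives 0.
  set f : ℝ → ℝ := fun y => if y = 1 then 0 else Real.exp (a / Real.log y) with hf
  have hfm : Measurable f := Measurable.ite (measurableSet_singleton 1) measurable_const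
    (by fun_prop)
  have hfeq : ∀ u : ℝ, 0 < u → f (Real.exp (-u)) = Real.exp (-(a / u)) := by
    intro u hu
    have : Real.exp (-u) ≠ 1 := by
      rw [Ne, Real.exp_eq_one_iff]; linarith
    rw [hf]
    simp only [this, if_false, Real.log_exp, div_neg]
  have hcont : ContinuousOn f (Icc 0 1) := by
    intro y hy
    rcases eq_or_ne y 1 with rfl | hy1
    · have hf1 : f 1 = 0 := by simp [hf]
      rw [← continuousWithinAt_sdiff_self, ContinuousWithinAt, hf1]
      have hlog : Tendsto Real.log (𝓝[Icc 0 1 \ {1}] 1) (𝓝[<] 0) := by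
        refine tendsto_nhdsWithin_iff.2 ⟨?_, ?_⟩
        · have := (Real.continuousAt_log one_ne_zero).tendsto
          rw [Real.log_one] at this
          exact this.mono_left nhdsWithin_le_nhds
        · filter_upwards [self_mem_nhdsWithin,
            nhdsWithin_le_nhds (lt_mem_nhds (zero_lt_one' ℝ))] with y hy hy0
          exact Real.log_neg hy0 (lt_of_le_of_ne hy.1.2 hy.2)
      have h1 : Tendsto (fun y => Real.exp (a * (Real.log y)⁻¹)) (𝓝[Icc 0 1 \ {1}] 1) (𝓝 0) :=
        Real.tendsto_exp_atBot.comp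
          ((tendsto_inv_nhdsLT_zero.comp hlog).const_mul_atBot ha)
      refine h1.congr' ?_
      filter_upwards [self_mem_nhdsWithin] with y hy
      have : y ≠ 1 := hy.2
      simp [hf, this, div_eq_mul_inv]
    · refine ContinuousAt.continuousWithinAt ?_
      have hev : (fun y => Real.exp (a * (Real.log y)⁻¹)) =ᶠ[𝓝 y] f := by
        filter_upwards [isOpen_ne.mem_nhds hy1] with z hz
        have : z ≠ 1 := hz
        simp [hf, this, div_eq_mul_inv]
      refine ContinuousAt.congr ?_ hev
      rcases eq_or_ne y 0 with rfl | hy0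
      · have h1 : Tendsto (fun y => Real.exp (a * (Real.log y)⁻¹)) (𝓝[≠] 0) (𝓝 1) := by
          have := ((tendsto_inv_atBot_zero.comp Real.tendsto_log_nhdsNE_zero).const_mul a).rexp
          simpa using this
        rw [continuousAt_iff_punctured_nhds]
        simpa using h1
      · have : Real.log y ≠ 0 := by
          rw [Real.log_ne_zero]
          exact ⟨hy0, hy1, by linarith [hy.1]⟩
        exact ((Real.continuousAt_log hy0).inv₀ this).const_mul a |>.rexp
  have hmain := tendsto_integral_comp_exp_neg hνs (hν.mono fun _ => le_of_lt) h hcont hfm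
  have hlim : ∫ u, f (Real.exp (-u)) ∂ν = ∫ u, Real.exp (-(a / u)) ∂ν :=
    integral_congr_ae (hν.mono hfeq)
  rw [hlim] at hmain
  refine hmain.congr' ?_
  -- Strict positivity is needed: at `u = 0` the expression `exp (-(a / u))` evaluates to 1, while
  -- `f` has the value 0.
  filter_upwards [hνs'] with n hn
  exact integral_congr_ae (hn.mono hfeq)

/-! ### The Gaussian sample and its conditional law -/

instance (μ : ℝ) : IsMarkovKernel (gaussianKernel μ) :=
  ⟨fun w => inferInstanceAs (IsProbabilityMeasure (gaussianReal μ w.toNNReal))⟩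

/-- Location-scale form, which replaces conditioning by a product measure. It also covers `w ≤ 0`,
where both sides are the point mass at `μ`. -/
lemma gaussianKernel_apply (μ w : ℝ) :
    gaussianKernel μ w = (gaussianReal 0 1).map fun z => μ + √w * z := by
  have h1 : (fun z => μ + √w * z) = (fun x => μ + x) ∘ fun z => √w * z := rfl
  rw [h1, ← Measure.map_map (by fun_prop) (by fun_prop), gaussianReal_map_const_mul,
    gaussianReal_map_const_add]
  change gaussianReal μ w.toNNReal = _
  congr 1
  · simp
  · ext
    rcases le_total 0 w with hw | hw
    · simp [Real.sq_sqrt hw, hw]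
    · simp [Real.sqrt_eq_zero_of_nonpos hw, hw]

lemma compProd_gaussianKernel (Q : Measure ℝ) [IsProbabilityMeasure Q] (μ : ℝ) :
    Q ⊗ₘ gaussianKernel μ =
      (Q.prod (gaussianReal 0 1)).map fun p => (p.1, μ + √p.1 * p.2) := by
  have hm : Measurable fun p : ℝ × ℝ => (p.1, μ + √p.1 * p.2) := by fun_prop
  ext s hs
  rw [Measure.compProd_apply hs, Measure.map_apply hm hs, Measure.prod_apply (hm hs)]
  refine lintegral_congr fun w => ?_
  rw [gaussianKernel_apply, Measure.map_apply (by fun_prop) (measurable_prodMk_left hs)]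
  rfl

lemma pi_compProd_gaussianKernel (Q : Measure ℝ) [IsProbabilityMeasure Q] (μ : ℝ) (n : ℕ) :
    Measure.pi (fun _ : Fin n => Q ⊗ₘ gaussianKernel μ) =
      ((Measure.pi fun _ : Fin n => Q).prod (Measure.pi fun _ : Fin n => gaussianReal 0 1)).map
        fun q i => (q.1 i, μ + √(q.1 i) * q.2 i) := by
  have hm : Measurable fun p : ℝ × ℝ => (p.1, μ + √p.1 * p.2) := by fun_prop
  have : ∀ i : Fin n, IsProbabilityMeasure
      ((Q.prod (gaussianReal 0 1)).map fun p => (p.1, μ + √p.1 * p.2)) := fun i =>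
    Measure.isProbabilityMeasure_map hm.aemeasurable
  have he := (measurePreserving_arrowProdEquivProdArrow ℝ ℝ (Fin n) (fun _ => Q)
    (fun _ => gaussianReal 0 1)).symm
  simp_rw [compProd_gaussianKernel]
  rw [← Measure.pi_map_pi (fun _ => hm.aemeasurable), ← he.map_eq,
    Measure.map_map (by fun_prop) (MeasurableEquiv.measurable _)]
  rfl

/-- The law of `(1 / w₁ + … + 1 / wₙ) / c` for independent `wᵢ` with law `Q`. -/
noncomputable def invSumLaw (Q : Measure ℝ) (n : ℕ) (c : ℝ) : Measure ℝ :=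
  (Measure.pi fun _ : Fin n => Q).map fun w => (∑ i, 1 / w i) / c

lemma measurable_sum_one_div_div (n : ℕ) (c : ℝ) :
    Measurable fun w : Fin n → ℝ => (∑ i, 1 / w i) / c := by fun_prop

lemma integral_invSumLaw (Q : Measure ℝ) (n : ℕ) (c : ℝ) {f : ℝ → ℝ} (hf : Measurable f) :
    ∫ u, f u ∂(invSumLaw Q n c) =
      ∫ w : Fin n → ℝ, f ((∑ i, 1 / w i) / c) ∂(Measure.pi fun _ => Q) :=
  integral_map (measurable_sum_one_div_div n c).aemeasurable hf.aestronglyMeasurable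

lemma aemeasurable_mle_sub {Ω : Type*} [MeasurableSpace Ω] {P : Measure Ω} {μ : ℝ}
    {X W : ℕ → Ω → ℝ} (hX : ∀ i, HasCondDistrib (X i) (W i) (gaussianKernel μ) P)
    (c : ℝ) (n : ℕ) :
    AEMeasurable (fun ω => c * (mle n (fun i => X i ω) (fun i => W i ω) - μ)) P := by
  have h1 := fun i => (hX i).aemeasurable_fst
  have h2 := fun i => (hX i).aemeasurable_snd
  unfold mle
  fun_prop

section Sample

variable {Ω : Type*} [MeasurableSpace Ω] {P : Measure Ω} [IsProbabilityMeasure P]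
  {Q : Measure ℝ} [IsProbabilityMeasure Q] {μ : ℝ} {X W : ℕ → Ω → ℝ}

lemma map_sample (hW : ∀ i, HasLaw (W i) Q P)
    (hX : ∀ i, HasCondDistrib (X i) (W i) (gaussianKernel μ) P)
    (hindep : iIndepFun (fun i ω => (X i ω, W i ω)) P) (n : ℕ) :
    P.map (fun ω (i : Fin n) => (W i ω, X i ω)) =
      ((Measure.pi fun _ : Fin n => Q).prod (Measure.pi fun _ : Fin n => gaussianReal 0 1)).map
        fun q i => (q.1 i, μ + √(q.1 i) * q.2 i) := by
  rw [← pi_compProd_gaussianKernel]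
  have h1 : iIndepFun (fun (i : Fin n) ω => (W i ω, X i ω)) P :=
    (hindep.comp (fun _ p => p.swap) fun _ => measurable_swap).precomp Fin.val_injective
  rw [(iIndepFun_iff_map_fun_eq_pi_map fun i : Fin n =>
    (hX i).aemeasurable_fst.prodMk (hX i).aemeasurable_snd).1 h1]
  congr 1
  ext1 i
  exact (HasLaw.prodMk_of_hasCondDistrib (hW i) (hX i)).map_eq

/-- Conditionally on the variances, the error of the estimate is Gaussian. -/
lemma charFun_mle (hQ : ∀ᵐ w ∂Q, 0 < w) (hW : ∀ i, HasLaw (W i) Q P)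
    (hX : ∀ i, HasCondDistrib (X i) (W i) (gaussianKernel μ) P)
    (hindep : iIndepFun (fun i ω => (X i ω, W i ω)) P) {n : ℕ} (hn : n ≠ 0) {c : ℝ} (hc : 0 < c)
    (t : ℝ) :
    charFun (P.map fun ω => √c * (mle n (fun i => X i ω) (fun i => W i ω) - μ)) t =
      ((∫ w : Fin n → ℝ, Real.exp (-(t ^ 2 / 2 / ((∑ i, 1 / w i) / c)))
        ∂(Measure.pi fun _ => Q) : ℝ) : ℂ) := by
  set f : (Fin n → ℝ × ℝ) → ℝ := fun p =>
    √c * ((∑ i, (p i).2 / (p i).1) / (∑ i, 1 / (p i).1) - μ) with hf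
  have hfm : Measurable f := by fun_prop
  have hsm : AEMeasurable (fun ω (i : Fin n) => (W i ω, X i ω)) P := aemeasurable_pi_iff.2
    fun i => (hX i).aemeasurable_fst.prodMk (hX i).aemeasurable_snd
  have hcomp : (fun ω => √c * (mle n (fun i => X i ω) (fun i => W i ω) - μ)) =
      f ∘ fun ω (i : Fin n) => (W i ω, X i ω) := by
    ext ω
    simp only [hf, Function.comp_apply, mle, Finset.sum_range]
  have hqm : Measurable fun (q : (Fin n → ℝ) × (Fin n → ℝ)) (i : Fin n) =>
      (q.1 i, μ + √(q.1 i) * q.2 i) := by fun_prop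
  rw [hcomp, ← AEMeasurable.map_map_of_aemeasurable hfm.aemeasurable hsm,
    map_sample hW hX hindep, Measure.map_map hfm hqm, charFun_apply_real,
    integral_map (hfm.comp hqm).aemeasurable (by fun_prop)]
  have hgm : Measurable fun q : (Fin n → ℝ) × (Fin n → ℝ) =>
      Complex.exp (t * (f (fun i => (q.1 i, μ + √(q.1 i) * q.2 i)) : ℝ) * Complex.I) := by
    have := hfm.comp hqm
    simp only [Function.comp_def] at this
    fun_prop
  have hint : Integrable (fun q : (Fin n → ℝ) × (Fin n → ℝ) =>
      Complex.exp (t * (f (fun i => (q.1 i, μ + √(q.1 i) * q.2 i)) : ℝ) * Complex.I))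
      ((Measure.pi fun _ : Fin n => Q).prod (Measure.pi fun _ : Fin n => gaussianReal 0 1)) := by
    refine (integrable_const (1 : ℝ)).mono' hgm.aestronglyMeasurable
      (Eventually.of_forall fun q => ?_)
    rw [← Complex.ofReal_mul, Complex.norm_exp_ofReal_mul_I]
  simp only [Function.comp_apply]
  rw [integral_prod _ hint, ← integral_complex_ofReal]
  have hae : ∀ᵐ w ∂(Measure.pi fun _ : Fin n => Q), ∀ i, 0 < w i :=
    eventually_all.2 fun i => Measure.tendsto_eval_ae_ae.eventually hQ
  refine integral_congr_ae ?_
  filter_upwards [hae] with w hw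
  have : Nonempty (Fin n) := ⟨⟨0, Nat.pos_of_ne_zero hn⟩⟩
  set S := ∑ i, 1 / w i with hS
  have hS0 : 0 < S := Finset.sum_pos (fun i _ => one_div_pos.2 (hw i)) Finset.univ_nonempty
  -- For fixed variances the error is a linear form in independent standard Gaussians, so the inner
  -- integral factors over the coordinates.
  have hlin : ∀ z : Fin n → ℝ, f (fun i => (w i, μ + √(w i) * z i)) =
      ∑ i, √c * (√(w i) / w i / S) * z i := by
    intro z
    have h1 : ∑ i, (μ + √(w i) * z i) / w i = μ * S + ∑ i, √(w i) / w i * z i := by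
      rw [hS, Finset.mul_sum, ← Finset.sum_add_distrib]
      refine Finset.sum_congr rfl fun i _ => ?_
      ring
    simp only [hf]
    rw [h1, add_div, mul_div_cancel_right₀ _ hS0.ne', add_sub_cancel_left, Finset.sum_div,
      Finset.mul_sum]
    refine Finset.sum_congr rfl fun i _ => ?_
    ring
  have hprod : ∀ z : Fin n → ℝ,
      Complex.exp (t * (f (fun i => (w i, μ + √(w i) * z i)) : ℝ) * Complex.I) =
      ∏ i, Complex.exp (((t * (√c * (√(w i) / w i / S)) : ℝ) : ℂ) * (z i : ℂ) * Complex.I) := by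
    intro z
    rw [hlin, ← Complex.exp_sum]
    congr 1
    push_cast
    rw [Finset.mul_sum, Finset.sum_mul]
    refine Finset.sum_congr rfl fun i _ => ?_
    ring
  simp_rw [hprod]
  rw [integral_fintype_prod_eq_prod (fun i (x : ℝ) =>
    Complex.exp (((t * (√c * (√(w i) / w i / S)) : ℝ) : ℂ) * (x : ℂ) * Complex.I))]
  simp_rw [← charFun_apply_real, charFun_gaussianReal]
  rw [← Complex.exp_sum]
  change _ = ((Real.exp _ : ℝ) : ℂ)
  rw [Complex.ofReal_exp]
  congr 1
  -- The squared weights give the conditional variance.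
  have hsum : ∑ i, (√(w i) / w i / S) ^ 2 = 1 / S := by
    have : ∀ i, (√(w i) / w i / S) ^ 2 = 1 / w i / S ^ 2 := by
      intro i
      have := hw i
      rw [div_pow, div_pow, Real.sq_sqrt this.le]
      field_simp
    simp_rw [this]
    rw [← Finset.sum_div, ← hS]
    field_simp
  have hreal : ∑ i, -((t * (√c * (√(w i) / w i / S))) ^ 2 / 2) = -(t ^ 2 / 2 / (S / c)) := by
    calc ∑ i, -((t * (√c * (√(w i) / w i / S))) ^ 2 / 2)
        = -(t ^ 2 * (√c) ^ 2 / 2) * ∑ i, (√(w i) / w i / S) ^ 2 := by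
          rw [Finset.mul_sum]
          refine Finset.sum_congr rfl fun i _ => ?_
          ring
      _ = _ := by
          rw [hsum, Real.sq_sqrt hc.le]
          field_simp
  rw [← hreal]
  push_cast
  refine Finset.sum_congr rfl fun i _ => ?_
  ring

instance (n : ℕ) (c : ℝ) : IsProbabilityMeasure (invSumLaw Q n c) :=
  Measure.isProbabilityMeasure_map (measurable_sum_one_div_div n c).aemeasurable

lemma laplace_invSumLaw (n : ℕ) (c lam : ℝ) :
    ∫ u, Real.exp (-(lam * u)) ∂(invSumLaw Q n c) =
      (∫ w, Real.exp (-(lam / c * (1 / w))) ∂Q) ^ n := by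
  rw [integral_invSumLaw Q n c (by fun_prop)]
  have h : ∀ w : Fin n → ℝ, Real.exp (-(lam * ((∑ i, 1 / w i) / c))) =
      ∏ i, Real.exp (-(lam / c * (1 / w i))) := by
    intro w
    rw [← Real.exp_sum, Finset.sum_neg_distrib, ← Finset.mul_sum]
    congr 1
    ring
  simp_rw [h]
  rw [integral_fintype_prod_eq_prod (fun (_ : Fin n) (x : ℝ) => Real.exp (-(lam / c * (1 / x))))]
  simp

lemma ae_invSumLaw_nonneg (hQ : ∀ᵐ w ∂Q, 0 < w) (n : ℕ) {c : ℝ} (hc : 0 ≤ c) :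
    ∀ᵐ u ∂(invSumLaw Q n c), 0 ≤ u := by
  have hae : ∀ᵐ w ∂(Measure.pi fun _ : Fin n => Q), ∀ i, 0 < w i :=
    eventually_all.2 fun i => Measure.tendsto_eval_ae_ae.eventually hQ
  rw [invSumLaw, ae_map_iff (measurable_sum_one_div_div n c).aemeasurable measurableSet_Ici]
  filter_upwards [hae] with w hw
  exact div_nonneg (Finset.sum_nonneg fun i _ => (one_div_pos.2 (hw i)).le) hc

lemma ae_invSumLaw_pos (hQ : ∀ᵐ w ∂Q, 0 < w) {n : ℕ} (hn : n ≠ 0) {c : ℝ} (hc : 0 < c) :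
    ∀ᵐ u ∂(invSumLaw Q n c), 0 < u := by
  have hae : ∀ᵐ w ∂(Measure.pi fun _ : Fin n => Q), ∀ i, 0 < w i :=
    eventually_all.2 fun i => Measure.tendsto_eval_ae_ae.eventually hQ
  have : Nonempty (Fin n) := ⟨⟨0, Nat.pos_of_ne_zero hn⟩⟩
  rw [invSumLaw, ae_map_iff (measurable_sum_one_div_div n c).aemeasurable measurableSet_Ioi]
  filter_upwards [hae] with w hw
  exact div_pos (Finset.sum_pos (fun i _ => one_div_pos.2 (hw i)) Finset.univ_nonempty) hc

/-- Convergence of the Laplace transforms of the normalized precisions implies convergence in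
distribution of the normalized estimate to the corresponding mixture of centred Gaussian laws. -/
lemma tendstoInDistribution_mle (hQ : ∀ᵐ w ∂Q, 0 < w) (hW : ∀ i, HasLaw (W i) Q P)
    (hX : ∀ i, HasCondDistrib (X i) (W i) (gaussianKernel μ) P)
    (hindep : iIndepFun (fun i ω => (X i ω, W i ω)) P) {c : ℕ → ℝ} (hc : ∀ᶠ n in atTop, 0 < c n)
    {ν : Measure ℝ} [IsProbabilityMeasure ν] (hν : ∀ᵐ u ∂ν, 0 < u)
    (hlap : ∀ lam : ℝ, 0 < lam → Tendsto
      (fun n : ℕ => (∫ w, Real.exp (-(lam / c n * (1 / w))) ∂Q) ^ n) atTop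
      (𝓝 (∫ u, Real.exp (-(lam * u)) ∂ν)))
    {Ω' : Type*} [MeasurableSpace Ω'] {P' : Measure Ω'} [IsProbabilityMeasure P'] {V : Ω' → ℝ}
    (hV : AEMeasurable V P')
    (hVchar : ∀ t : ℝ, charFun (P'.map V) t = ((∫ u, Real.exp (-(t ^ 2 / 2 / u)) ∂ν : ℝ) : ℂ)) :
    TendstoInDistribution
      (fun (n : ℕ) ω => √(c n) * (mle n (fun i => X i ω) (fun i => W i ω) - μ))
      atTop V (fun _ => P) P' := by
  refine ⟨fun n => aemeasurable_mle_sub hX _ n, hV, ?_⟩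
  refine ProbabilityMeasure.tendsto_iff_tendsto_charFun.2 fun t => ?_
  simp only [ProbabilityMeasure.coe_mk]
  -- The case `t = 0` is separate because `a = t ^ 2 / 2` must be positive below.
  rcases eq_or_ne t 0 with rfl | ht
  · have h1 : ∀ n, IsProbabilityMeasure (P.map fun ω =>
        √(c n) * (mle n (fun i => X i ω) (fun i => W i ω) - μ)) := fun n =>
      Measure.isProbabilityMeasure_map (aemeasurable_mle_sub hX _ n)
    have h2 := Measure.isProbabilityMeasure_map hV
    simp
  rw [hVchar]
  -- The absolute value keeps the laws on `[0, ∞)` for every `n`, although `c n` is only eventually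
  -- positive.
  have hconv : Tendsto (fun n : ℕ => ∫ u, Real.exp (-(t ^ 2 / 2 / u))
      ∂(invSumLaw Q n |c n|)) atTop (𝓝 (∫ u, Real.exp (-(t ^ 2 / 2 / u)) ∂ν)) := by
    refine tendsto_integral_exp_neg_div (fun n => ae_invSumLaw_nonneg hQ n (abs_nonneg _)) ?_ hν
      ?_ (by positivity)
    · filter_upwards [hc, eventually_ne_atTop 0] with n hcn hn
      exact ae_invSumLaw_pos hQ hn (abs_pos.2 hcn.ne')
    · intro lam hlam
      refine (hlap lam hlam).congr' ?_
      filter_upwards [hc] with n hcn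
      rw [laplace_invSumLaw, abs_of_pos hcn]
  refine ((Complex.continuous_ofReal.tendsto _).comp hconv).congr' ?_
  filter_upwards [hc, eventually_ne_atTop 0] with n hcn hn
  rw [charFun_mle hQ hW hX hindep hn hcn, Function.comp_apply, abs_of_pos hcn,
    integral_invSumLaw _ _ _ (measurable_exp_neg_div _)]

end Sample

/-- Conditioning on `U` gives the same mixture of Gaussian characteristic functions as in
`charFun_mle`, with `U` in the role of the normalized precision. -/
lemma charFun_rpow_mul_gaussian {Ω' : Type*} [MeasurableSpace Ω'] {P' : Measure Ω'}
    [IsProbabilityMeasure P'] {U Z : Ω' → ℝ} {ν : Measure ℝ} [IsProbabilityMeasure ν]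
    (hν : ∀ᵐ u ∂ν, 0 < u) (hU : HasLaw U ν P') (hZ : HasLaw Z (gaussianReal 0 1) P')
    (hUZ : IndepFun U Z P') (t : ℝ) :
    charFun (P'.map fun ω' => (U ω') ^ (-(1 / 2) : ℝ) * Z ω') t =
      ((∫ u, Real.exp (-(t ^ 2 / 2 / u)) ∂ν : ℝ) : ℂ) := by
  have hm : Measurable fun p : ℝ × ℝ => p.1 ^ (-(1 / 2) : ℝ) * p.2 := by fun_prop
  have hcomp : (fun ω' => (U ω') ^ (-(1 / 2) : ℝ) * Z ω') =
      (fun p : ℝ × ℝ => p.1 ^ (-(1 / 2) : ℝ) * p.2) ∘ fun ω' => (U ω', Z ω') := rfl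
  rw [hcomp, ← AEMeasurable.map_map_of_aemeasurable hm.aemeasurable
    (hU.aemeasurable.prodMk hZ.aemeasurable),
    (indepFun_iff_map_prod_eq_prod_map_map hU.aemeasurable hZ.aemeasurable).1 hUZ, hU.map_eq,
    hZ.map_eq, charFun_apply_real, integral_map hm.aemeasurable (by fun_prop)]
  have hint : Integrable (fun p : ℝ × ℝ =>
      Complex.exp (t * ((p.1 ^ (-(1 / 2) : ℝ) * p.2 : ℝ) : ℂ) * Complex.I))
      (ν.prod (gaussianReal 0 1)) := by
    refine (integrable_const (1 : ℝ)).mono' (by fun_prop) (Eventually.of_forall fun q => ?_)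
    rw [← Complex.ofReal_mul, Complex.norm_exp_ofReal_mul_I]
  rw [integral_prod _ hint, ← integral_complex_ofReal]
  refine integral_congr_ae ?_
  filter_upwards [hν] with u hu
  have h1 : ∀ z : ℝ, Complex.exp (t * ((u ^ (-(1 / 2) : ℝ) * z : ℝ) : ℂ) * Complex.I) =
      Complex.exp (((t * u ^ (-(1 / 2) : ℝ) : ℝ) : ℂ) * (z : ℂ) * Complex.I) := by
    intro z; congr 1; push_cast; ring
  simp only [h1]
  rw [← charFun_apply_real, charFun_gaussianReal]
  change _ = ((Real.exp _ : ℝ) : ℂ)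
  rw [Complex.ofReal_exp]
  congr 1
  have h2 : (u ^ (-(1 / 2) : ℝ)) ^ 2 = u⁻¹ := by
    rw [← Real.rpow_natCast, ← Real.rpow_mul hu.le]; norm_num [Real.rpow_neg_one]
  have h3 : -((t * u ^ (-(1 / 2) : ℝ)) ^ 2 / 2) = -(t ^ 2 / 2 / u) := by
    rw [mul_pow, h2]; ring
  rw [← h3]
  push_cast
  ring

/-- The estimate is the unique maximizer of the likelihood. -/
lemma logLik_lt_logLik_mle {g : ℝ → ℝ} (hg_pos : ∀ w : ℝ, 0 < w → 0 < g w) {n : ℕ} (hn : 1 ≤ n)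
    {x w : ℕ → ℝ} (hw : ∀ i, 0 < w i) {m : ℝ} (hm : m ≠ mle n x w) :
    logLik g n x w m < logLik g n x w (mle n x w) := by
  set S := ∑ i ∈ Finset.range n, 1 / w i with hS
  have hS0 : 0 < S := Finset.sum_pos (fun i _ => one_div_pos.2 (hw i))
    (Finset.nonempty_range_iff.2 (by omega))
  have hlog : ∀ (i : ℕ) (a : ℝ), Real.log (jointDensity g a (x i) (w i)) =
      Real.log (g (w i) * (√(2 * Real.pi * w i))⁻¹) + -(x i - a) ^ 2 / (2 * w i) := by
    intro i a
    have h1 := hg_pos _ (hw i)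
    have h2 := hw i
    have h3 := Real.pi_pos
    rw [jointDensity, ← mul_assoc, Real.log_mul (by positivity) (Real.exp_pos _).ne',
      Real.log_exp]
  have hT : ∑ i ∈ Finset.range n, x i / w i = mle n x w * S := by
    rw [mle, div_mul_cancel₀ _ hS0.ne']
  -- The log-likelihood is a quadratic in `m` with leading coefficient `-S / 2`; completing the
  -- square locates its maximum.
  have hdiff : logLik g n x w (mle n x w) - logLik g n x w m = S / 2 * (m - mle n x w) ^ 2 := by
    set a := mle n x w
    rw [logLik, logLik, ← Finset.sum_sub_distrib]
    calc _ = ∑ i ∈ Finset.range n, ((a - m) * (x i / w i) + (m ^ 2 - a ^ 2) / 2 * (1 / w i)) := by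
          refine Finset.sum_congr rfl fun i _ => ?_
          have := hw i
          rw [hlog, hlog]
          field_simp
          ring
      _ = (a - m) * (a * S) + (m ^ 2 - a ^ 2) / 2 * S := by
          rw [Finset.sum_add_distrib, ← Finset.mul_sum, ← Finset.mul_sum, hT]
      _ = _ := by ring
  have : 0 < S / 2 * (m - mle n x w) ^ 2 := by
    have := sq_pos_of_ne_zero (sub_ne_zero.2 hm)
    positivity
  linarith

/-! ### Limits of the Laplace transforms of the normalized precisions -/

section Limits

variable {g : ℝ → ℝ} [IsProbabilityMeasure (mixingLaw g)]

/-- The limit `(1 + x n / n) ^ n → exp x` for convergent `x n`, combined with `one_sub_laplace`. -/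
lemma tendsto_laplace_pow {r : ℕ → ℝ} (hr : ∀ᶠ n in atTop, 0 < r n) {a : ℝ}
    (h : Tendsto (fun n : ℕ => n * (r n * ∫ u in Ioi (0 : ℝ), Real.exp (-(r n * u)) *
      G g (1 / u))) atTop (𝓝 a)) :
    Tendsto (fun n : ℕ => (∫ w, Real.exp (-(r n * (1 / w))) ∂(mixingLaw g)) ^ n) atTop
      (𝓝 (Real.exp (-a))) := by
  have h1 : Tendsto (fun n : ℕ => n *
      -(1 - ∫ w, Real.exp (-(r n * (1 / w))) ∂(mixingLaw g))) atTop (𝓝 (-a)) := by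
    refine h.neg.congr' ?_
    filter_upwards [hr] with n hn
    rw [one_sub_laplace hn, mul_neg]
  refine (Real.tendsto_one_add_pow_exp_of_tendsto h1).congr fun n => ?_
  congr 1
  ring

/-- The Laplace transforms of the precisions normalized by `B`, for index `β < 1`. -/
lemma tendsto_laplace_div_B (hg_cont : ContinuousOn g (Ioi 0))
    (hg_pos : ∀ w : ℝ, 0 < w → 0 < g w) {β : ℝ} (hβ0 : 0 < β) (hβ1 : β < 1)
    (hG : RegVarAt (G g) (𝓝[>] 0) β) {lam : ℝ} (hlam : 0 < lam) :
    Tendsto (fun n : ℕ => (∫ w, Real.exp (-(lam / B g n * (1 / w))) ∂(mixingLaw g)) ^ n) atTop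
      (𝓝 (Real.exp (-(Real.Gamma (1 - β) * lam ^ β)))) := by
  have hn1 : ∀ᶠ n : ℕ in atTop, (1 : ℝ) < n :=
    tendsto_natCast_atTop_atTop.eventually (eventually_gt_atTop 1)
  refine tendsto_laplace_pow (hn1.mono fun n hn => div_pos hlam (B_pos hn)) ?_
  have h := (tendsto_laplace_of_regVar measurable_tail antitoneOn_tail (tail_pos hg_cont hg_pos)
    (fun _ => G_le_one _) hβ0 hβ1 (tendsto_tail_mul_div hG) hlam).comp
    ((tendsto_B hg_cont hg_pos).comp tendsto_natCast_atTop_atTop)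
  refine h.congr' ?_
  filter_upwards [hn1] with n hn
  have hB := B_pos (g := g) hn
  -- Substitute `u = v * B g n`; the factor `n` is the reciprocal of the tail at `B g n`.
  have hsub := integral_comp_mul_right_Ioi
    (fun u => Real.exp (-(lam / B g n * u)) * G g (1 / u)) 0 hB
  rw [zero_mul, smul_eq_mul] at hsub
  simp only [Function.comp_apply, G_one_div_B hn]
  calc ∫ v in Ioi (0 : ℝ), lam * Real.exp (-(lam * v)) * (G g (1 / (v * B g n)) / (1 / n))
      = ∫ v in Ioi (0 : ℝ), n * lam *
          (Real.exp (-(lam / B g n * (v * B g n))) * G g (1 / (v * B g n))) := by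
        congr 1; ext v
        rw [show lam / B g n * (v * B g n) = lam * v by field_simp]
        have : (n : ℝ) ≠ 0 := by positivity
        field_simp
    _ = _ := by
        rw [integral_const_mul, hsub]
        field_simp

/-- The Laplace transforms of the precisions normalized by `A`, for index `1`. -/
lemma tendsto_laplace_div_A (hg_cont : ContinuousOn g (Ioi 0))
    (hg_pos : ∀ w : ℝ, 0 < w → 0 < g w) (hG : RegVarAt (G g) (𝓝[>] 0) 1)
    {lam : ℝ} (hlam : 0 < lam) :
    Tendsto (fun n : ℕ => (∫ w, Real.exp (-(lam / A g n * (1 / w))) ∂(mixingLaw g)) ^ n) atTop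
      (𝓝 (Real.exp (-lam))) := by
  have hn1 : ∀ᶠ n : ℕ in atTop, (1 : ℝ) < n :=
    tendsto_natCast_atTop_atTop.eventually (eventually_gt_atTop 1)
  have hA : ∀ᶠ n : ℕ in atTop, 0 < A g n :=
    tendsto_natCast_atTop_atTop.eventually (regVarAt_A hg_cont hg_pos hG).1
  refine tendsto_laplace_pow (hA.mono fun n hn => div_pos hlam hn) ?_
  have h := ((tendsto_laplace_of_regVar_one measurable_tail antitoneOn_tail
    (fun _ => G_nonneg _) (tail_pos hg_cont hg_pos)
    (fun _ => G_le_one _) (tendsto_tail_mul_div hG) hlam).comp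
    ((tendsto_B hg_cont hg_pos).comp tendsto_natCast_atTop_atTop)).const_mul lam
  rw [mul_one] at h
  refine h.congr' ?_
  filter_upwards [hn1, hA] with n hn hAn
  have hn0 : (n : ℝ) ≠ 0 := by positivity
  simp only [Function.comp_apply, G_one_div_B hn]
  have hL : A g n = n * ∫ u in (0 : ℝ)..B g n, G g (1 / u) := rfl
  set L := ∫ u in (0 : ℝ)..B g n, G g (1 / u)
  have hL0 : L ≠ 0 := by
    rintro h0
    rw [hL, h0, mul_zero] at hAn
    exact lt_irrefl _ hAn
  -- The tail at `B g n` is `1 / n`, so the rate in the boundary Abelian theorem is exactly the one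
  -- set by `A`.
  have hr : lam * (1 / n) / L = lam / A g n := by
    rw [hL]; field_simp
  rw [hr, hL]
  field_simp

/-- The stable subordinator law exists, as the limit law of the normalized precisions. -/
lemma exists_isStableSubordinatorLaw (hg_cont : ContinuousOn g (Ioi 0))
    (hg_pos : ∀ w : ℝ, 0 < w → 0 < g w) {β : ℝ} (hβ0 : 0 < β) (hβ1 : β < 1)
    (hG : RegVarAt (G g) (𝓝[>] 0) β) : ∃ ν : Measure ℝ, IsStableSubordinatorLaw β ν := by
  have hn1 : ∀ᶠ n : ℕ in atTop, (1 : ℝ) < n :=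
    tendsto_natCast_atTop_atTop.eventually (eventually_gt_atTop 1)
  have hΓ : 0 < Real.Gamma (1 - β) := Real.Gamma_pos_of_pos (by linarith)
  obtain ⟨ν, h1, h2, h3⟩ := exists_measure_of_tendsto_laplace
    (νs := fun n => invSumLaw (mixingLaw g) n |B g n|)
    (Φ := fun lam => Real.exp (-(Real.Gamma (1 - β) * lam ^ β)))
    (fun n => ae_invSumLaw_nonneg ae_mixingLaw_pos n (abs_nonneg _))
    (fun lam hlam => by
      refine (tendsto_laplace_div_B hg_cont hg_pos hβ0 hβ1 hG hlam).congr' ?_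
      filter_upwards [hn1] with n hn
      rw [laplace_invSumLaw, abs_of_pos (B_pos hn)])
    (by
      have := ((Real.continuousAt_rpow_const 0 β (Or.inr hβ0.le)).tendsto.const_mul
        (Real.Gamma (1 - β))).neg.rexp
      rw [Real.zero_rpow hβ0.ne', mul_zero, neg_zero, Real.exp_zero] at this
      exact this.mono_left nhdsWithin_le_nhds)
    (Real.tendsto_exp_neg_atTop_nhds_zero.comp
      ((tendsto_rpow_atTop hβ0).const_mul_atTop hΓ))
  exact ⟨ν, h1, h2, h3⟩

end Limits

end VarianceMixture

/-! ### The main theorem -/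

theorem theorem1
    {Ω : Type*} [MeasurableSpace Ω] (P : Measure Ω) [IsProbabilityMeasure P]
    (g : ℝ → ℝ) (hg_cont : ContinuousOn g (Ioi 0)) (hg_pos : ∀ w : ℝ, 0 < w → 0 < g w)
    (μ : ℝ) (X W : ℕ → Ω → ℝ)
    -- the pairs `(X i, W i)` are IID, `W i` has density `g`, and `X i | W i ∼ N(μ, W i)`
    (hW : ∀ i, HasLaw (W i) (mixingLaw g) P)
    (hX : ∀ i, HasCondDistrib (X i) (W i) (gaussianKernel μ) P)
    (hindep : iIndepFun (fun i ω => (X i ω, W i ω)) P)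
    (β : ℝ) (hβ0 : 0 < β) (hβ1 : β ≤ 1)
    (hG : RegVarAt (VarianceMixture.G g) (𝓝[>] 0) β)
    {Ω' : Type*} [MeasurableSpace Ω'] (P' : Measure Ω') [IsProbabilityMeasure P']
    (Z : Ω' → ℝ) (hZ : HasLaw Z (gaussianReal 0 1) P') :
    -- `mle` is the unique maximizer of the likelihood
    (∀ᵐ ω ∂P, ∀ n : ℕ, 1 ≤ n → ∀ m : ℝ, m ≠ mle n (fun i => X i ω) (fun i => W i ω) →
      logLik g n (fun i => X i ω) (fun i => W i ω) m <
        logLik g n (fun i => X i ω) (fun i => W i ω)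
          (mle n (fun i => X i ω) (fun i => W i ω))) ∧
    -- (a)
    (RegVarAt (VarianceMixture.B g) atTop (1 / β) ∧
      (β = 1 → RegVarAt (VarianceMixture.A g) atTop 1)) ∧
    -- (b)
    (β < 1 →
      (∃ ν : Measure ℝ, IsStableSubordinatorLaw β ν) ∧
      ∀ (ν : Measure ℝ) (U : Ω' → ℝ), IsStableSubordinatorLaw β ν → HasLaw U ν P' →
        IndepFun U Z P' →
        TendstoInDistribution
          (fun (n : ℕ) ω => √(VarianceMixture.B g n) *
            (mle n (fun i => X i ω) (fun i => W i ω) - μ))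
          atTop (fun ω' => (U ω') ^ (-(1 / 2) : ℝ) * Z ω') (fun _ => P) P') ∧
    -- (c)
    (β = 1 → ∫⁻ w, ENNReal.ofReal (1 / w) ∂(mixingLaw g) = ∞ →
      TendstoInDistribution
        (fun (n : ℕ) ω => √(VarianceMixture.A g n) *
          (mle n (fun i => X i ω) (fun i => W i ω) - μ))
        atTop Z (fun _ => P) P') := by
  have hQprob : IsProbabilityMeasure (mixingLaw g) := by
    rw [← (hW 0).map_eq]
    exact Measure.isProbabilityMeasure_map (hW 0).aemeasurable
  have hβeq : β = 1 → RegVarAt (VarianceMixture.G g) (𝓝[>] 0) 1 := fun h => h ▸ hG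
  refine ⟨?_, ⟨regVarAt_B hg_cont hg_pos hβ0 hG, fun h => regVarAt_A hg_cont hg_pos (hβeq h)⟩,
    fun hβ => ⟨exists_isStableSubordinatorLaw hg_cont hg_pos hβ0 hβ hG, ?_⟩, fun hβ _ => ?_⟩
  · have hpos : ∀ᵐ ω ∂P, ∀ i, 0 < W i ω := ae_all_iff.2 fun i => by
      refine ae_of_ae_map (hW i).aemeasurable (p := fun w => 0 < w) ?_
      rw [(hW i).map_eq]
      exact ae_mixingLaw_pos
    filter_upwards [hpos] with ω hω n hn m hm
    exact logLik_lt_logLik_mle hg_pos hn hω hm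
  · intro ν U hν hU hUZ
    have := hν.isProb
    refine tendstoInDistribution_mle ae_mixingLaw_pos hW hX hindep
      (tendsto_natCast_atTop_atTop.eventually
        (p := fun t => 0 < VarianceMixture.B g t) (regVarAt_B hg_cont hg_pos hβ0 hG).1) hν.ae_pos
      (fun lam hlam => ?_) ?_ (charFun_rpow_mul_gaussian hν.ae_pos hU hZ hUZ)
    · rw [hν.laplace lam hlam]
      exact tendsto_laplace_div_B hg_cont hg_pos hβ0 hβ hG hlam
    · exact (hU.aemeasurable.pow_const _).mul hZ.aemeasurable
  -- `exp (-lam)` is the Laplace transform of the point mass at 1, for which the Gaussian mixture is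
  -- the standard Gaussian itself.
  · refine tendstoInDistribution_mle (ν := Measure.dirac 1) ae_mixingLaw_pos hW hX hindep
      (tendsto_natCast_atTop_atTop.eventually
        (p := fun t => 0 < VarianceMixture.A g t) (regVarAt_A hg_cont hg_pos (hβeq hβ)).1)
      (by simp [ae_dirac_eq]) (fun lam hlam => ?_) hZ.aemeasurable fun t => ?_
    · rw [integral_dirac, mul_one]
      exact tendsto_laplace_div_A hg_cont hg_pos (hβeq hβ) hlam
    · rw [hZ.map_eq, charFun_gaussianReal, integral_dirac, div_one, Complex.ofReal_exp]
      congr 1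
      push_cast
      simp
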